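/- Let $n\ge 1$, let $\Omega\subseteq\mathbb{R}^n$ be a non-empty open set, let $H=L^2(\Omega)$ (complex valued), and let $V$ be a closed subspace of $H^1(\Omega)$ that contains $H^1_0(\Omega)$, with norm $\|v\|_V^2=\|v\|_{L^2(\Omega)}^2+\|\nabla v\|_{L^2(\Omega)^n}^2$. Let $V^*$ be the anti-dual space of $V$ (bounded conjugate-linear functionals), and identify $h\in H$ with the functional $w\mapsto (h\,|\,w)_H$ in $V^*$. Let $A:\mathbb{R}\times\Omega\to\mathbb{C}^{n\times n}$ be measurable, and suppose that there are $\lambda,\Lambda>0$ such that $$\lambda|\xi|^2\le \Re\big(A(t,x)\xi\cdot\overline{\xi}\big),\qquad |A(t,x)\xi\cdot\zeta|\le\Lambda|\xi||\zeta|$$ for all $t\in\mathbb{R}$, almost every $x\in\Omega$ and all $\xi,\zeta\in\mathbb{C}^n$. For (almost every) $t$ define $\mathfrak{A}(t):V\to V^*$ by $\langle\mathfrak{A}(t)v,w\rangle=\int_\Omega A(t,x)\nabla v(x)\cdot\overline{\nabla w(x)}\,dx$. Let $D_t^{1/2}$ and $H_t$ be the operators in the variable $t\in\mathbb{R}$ with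 Fourier symbols $|\tau|^{1/2}$ and $i\,\mathrm{sgn}(\tau)$ (with the convention that $\frac{d}{dt}$ has the symbol $i\tau$), and let $H^{1/2}(\mathbb{R};H)$ be the space of all $u\in L^2(\mathbb{R};H)$ with $D_t^{1/2}u\in L^2(\mathbb{R};H)$. Let $\mathsf{E}=H^{1/2}(\mathbb{R};H)\cap L^2(\mathbb{R};V)$ with norm $$\|u\|_{\mathsf{E}}^2=\int_{\mathbb{R}}\|u(t)\|_{L^2(\Omega)}^2+\|D_t^{1/2}u(t)\|_{L^2(\Omega)}^2+\|\nabla u(t)\|_{L^2(\Omega)^n}^2\,dt,$$ let $\mathsf{E}^*$ be its anti-dual space, and let $\mathfrak{L}:\mathsf{E}\to\mathsf{E}^*$ be the bounded operator $$(\mathfrak{L}u)(w)=\int_{\mathbb{R}}-\big(D_t^{1/2}u\,\big|\,D_t^{1/2}H_tw\big)_H+\langle\mathfrak{A}(t)u(t),w(t)\rangle\,dt\qquad(u,w\in\mathsf{E}),$$ which extends $u\mapsto u'+\mathfrak{A}u$. Functions $f\in L^2(\mathbb{R};V^*)$ act on $\mathsf{E}$ by $w\mapsto\int_{\mathbb{R}}\langle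 f(t),w(t)\rangle\,dt$; in this sense $L^2(\mathbb{R};H)\subseteq L^2(\mathbb{R};V^*)\subseteq\mathsf{E}^*$. Let $\theta\in\mathbb{C}$ with $\Re\theta>0$. Then the following hold. (i) For each $f\in\mathsf{E}^*$ there is a unique $u\in\mathsf{E}$ with $(\theta+\mathfrak{L})u=f$, and $$\|u\|_{\mathsf{E}}\le\sqrt{2}\,\max\Big\{\frac{\Lambda+1}{\lambda},\frac{|\Im\theta|+1}{\Re\theta}\Big\}\|f\|_{\mathsf{E}^*}.$$ (ii) If in addition $f\in L^2(\mathbb{R};V^*)$, then $u\in H^1(\mathbb{R};V^*)$, and $u$ is the unique solution of $$u'(t)+\theta u(t)+\mathfrak{A}(t)u(t)=f(t)\qquad(\text{a.e. }t\in\mathbb{R})$$ in the class $H^1(\mathbb{R};V^*)\cap L^2(\mathbb{R};V)$. (iii) If even $f\in L^2(\mathbb{R};H)$, then $$\|u\|_{L^2(\mathbb{R};H)}\le\frac{1}{\Re\theta}\|f\|_{L^2(\mathbb{R};H)}.$$ In particular, the part of $\mathfrak{L}$ in $L^2(\mathbb{R};H)$ (the operator $u\mapsto\mathfrak{L}u$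 on all $u\in\mathsf{E}$ with $\mathfrak{L}u\in L^2(\mathbb{R};H)$) is maximal accretive with domain $$\mathsf{D}=\{u\in H^1(\mathbb{R};V^*)\cap L^2(\mathbb{R};V):\ u'+\mathfrak{A}u\in L^2(\mathbb{R};H)\}.$$ Here an operator $T$ in a Hilbert space is called maximal accretive if it is densely defined, $\Re(Tu\,|\,u)\ge 0$ for all $u$ in its domain, $z+T$ is invertible with $\|(z+T)^{-1}\|\le 1/\Re z$ for all $z\in\mathbb{C}$ with $\Re z>0$, and $T$ has no proper accretive extension. -/

import Mathlib

open MeasureTheory FourierTransform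
open scoped ENNReal ContDiff ComplexConjugate

noncomputable section

namespace NonAuto

/-! ### Sobolev spaces on an open set `Ω ⊆ ℝⁿ` -/

/-- `L²(Ω)`. -/
abbrev L2 {n : ℕ} (Ω : Set (EuclideanSpace ℝ (Fin n))) : Type :=
  Lp ℂ 2 (volume.restrict Ω)

/-- `L²(Ω)ⁿ`. -/
abbrev L2vec {n : ℕ} (Ω : Set (EuclideanSpace ℝ (Fin n))) : Type :=
  Lp (EuclideanSpace ℂ (Fin n)) 2 (volume.restrict Ω)

/-- The Hilbert space `L²(Ω) × L²(Ω)ⁿ` with norm `(‖v‖² + ‖g‖²)^{1/2}`. Sobolev functions `v` are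
represented in it as the pairs `(v, ∇v)`. -/
abbrev L2pair {n : ℕ} (Ω : Set (EuclideanSpace ℝ (Fin n))) : Type :=
  WithLp 2 (L2 Ω × L2vec Ω)

/-- The pair `(v, g)` satisfies `g = ∇v` in the sense of weak derivatives on `Ω`. -/
def IsWeakGradient {n : ℕ} (Ω : Set (EuclideanSpace ℝ (Fin n))) (p : L2pair Ω) : Prop :=
  ∀ φ : EuclideanSpace ℝ (Fin n) → ℂ, ContDiff ℝ ∞ φ → HasCompactSupport φ → tsupport φ ⊆ Ω →
    ∀ i : Fin n,
      ∫ x in Ω, p.fst x * fderiv ℝ φ x (EuclideanSpace.single i 1) = -∫ x in Ω, p.snd x i * φ x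

/-- `p` is the pair `(φ, ∇φ)` of a test function `φ ∈ C_c^∞(Ω)`. -/
def IsTestPair {n : ℕ} (Ω : Set (EuclideanSpace ℝ (Fin n))) (p : L2pair Ω) : Prop :=
  ∃ φ : EuclideanSpace ℝ (Fin n) → ℂ, ContDiff ℝ ∞ φ ∧ HasCompactSupport φ ∧ tsupport φ ⊆ Ω ∧
    (p.fst =ᵐ[volume.restrict Ω] φ) ∧
    ∀ i : Fin n, (fun x => p.snd x i) =ᵐ[volume.restrict Ω]
      fun x => fderiv ℝ φ x (EuclideanSpace.single i 1)

/-- `V` is a closed subspace of `H¹(Ω)` that contains `H¹₀(Ω)`, the closure of the test functions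
in `H¹(Ω)`. The norm of `V` is the one of `H¹(Ω)`, that is, `(‖v‖² + ‖∇v‖²)^{1/2}`. -/
structure IsFormDomain {n : ℕ} (Ω : Set (EuclideanSpace ℝ (Fin n)))
    (V : Submodule ℂ (L2pair Ω)) : Prop where
  isClosed : IsClosed (V : Set (L2pair Ω))
  le_sobolev : ∀ p ∈ V, IsWeakGradient Ω p
  sobolevZero_le : closure {p | IsTestPair Ω p} ⊆ (V : Set (L2pair Ω))

section Space

variable {n : ℕ} {Ω : Set (EuclideanSpace ℝ (Fin n))} (V : Submodule ℂ (L2pair Ω))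

/-- The subspace `V` as a type, with its inherited inner product. It is a type of its own only to
keep the search for instances short. -/
def FormSpace : Type := V

instance : NormedAddCommGroup (FormSpace V) := inferInstanceAs (NormedAddCommGroup V)

instance : InnerProductSpace ℂ (FormSpace V) := inferInstanceAs (InnerProductSpace ℂ V)

/-- The inclusion of `V`, which is `v ↦ (v, ∇v)`. -/
def incl : FormSpace V →L[ℂ] L2pair Ω := V.subtypeL

/-- The embedding `V → H = L²(Ω)`. -/
def emb : FormSpace V →L[ℂ] L2 Ω :=
  (WithLp.fstL 2 ℂ (L2 Ω) (L2vec Ω)).comp (incl V)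

/-- The gradient `∇_V : V → L²(Ω)ⁿ`. -/
def grad : FormSpace V →L[ℂ] L2vec Ω :=
  (WithLp.sndL 2 ℂ (L2 Ω) (L2vec Ω)).comp (incl V)

/-- The anti-dual of a complex normed space: bounded conjugate-linear functionals. -/
abbrev AntiDual (X : Type*) [NormedAddCommGroup X] [NormedSpace ℂ X] : Type _ :=
  X →L⋆[ℂ] ℂ

/-- The embedding `H → V*`, which sends `h` to `w ↦ (h | w)_H`. The inner product of the
mathematical text is linear in its first argument, so `(a | b)` is `inner ℂ b a`. -/
def embDual : L2 Ω →L[ℂ] AntiDual (FormSpace V) :=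
  LinearMap.mkContinuous
    { toFun := fun h => (innerSLFlip ℂ h).comp (emb V)
      map_add' := by intro a b; ext w; simp
      map_smul' := by intro c a; ext w; simp } ‖emb V‖ (by
    intro h
    refine ContinuousLinearMap.opNorm_le_bound _ (by positivity) fun w => ?_
    have h1 : ‖inner ℂ (emb V w) h‖ ≤ ‖emb V w‖ * ‖h‖ := norm_inner_le_norm _ _
    have h2 := (emb V).le_opNorm w
    have : ‖inner ℂ (emb V w) h‖ ≤ ‖emb V‖ * ‖h‖ * ‖w‖ := by
      nlinarith [norm_nonneg h]
    simpa using this)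

end Space

/-! ### Function spaces in time -/

/-- `L²(ℝ; X)`. -/
abbrev L2t (X : Type*) [NormedAddCommGroup X] : Type _ := Lp X 2 (volume : Measure ℝ)

/-- `u' ∈ L²(ℝ; X)` is the weak derivative of `u ∈ L²(ℝ; X)`. Thus `u ∈ H¹(ℝ; X)` if and only if
such a `u'` exists. -/
def HasWeakDeriv {X : Type*} [NormedAddCommGroup X] [NormedSpace ℂ X] (u u' : L2t X) : Prop :=
  ∀ φ : ℝ → ℂ, ContDiff ℝ ∞ φ → HasCompactSupport φ →
    ∫ t, deriv φ t • u t = -∫ t, φ t • u' t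

section Fourier

variable {X : Type*} [NormedAddCommGroup X] [InnerProductSpace ℂ X] [CompleteSpace X]

/-- `g = D_t^{1/2} u`, where `D_t^{1/2}` has the Fourier symbol `|τ|^{1/2}`. The frequency variable
`ξ` of `𝓕` is normalized so that `τ = 2πξ`. Thus `u ∈ H^{1/2}(ℝ; X)` if and only if such a `g`
exists. -/
def IsHalfDeriv (u g : L2t X) : Prop :=
  ∀ᵐ ξ : ℝ, 𝓕 g ξ = (((|2 * Real.pi * ξ|) ^ (1 / 2 : ℝ) : ℝ) : ℂ) • 𝓕 u ξ

lemma hilbertSymbol_memLp :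
    MemLp (fun ξ : ℝ => Complex.I * ((Real.sign ξ : ℝ) : ℂ)) ∞ (volume : Measure ℝ) := by
  have hm : Measurable Real.sign := by
    unfold Real.sign
    exact Measurable.ite measurableSet_Iio measurable_const
      (Measurable.ite measurableSet_Ioi measurable_const measurable_const)
  refine memLp_top_of_bound (C := 1) (by fun_prop) (Filter.Eventually.of_forall fun ξ => ?_)
  rcases Real.sign_apply_eq ξ with h | h | h <;> simp [h]

/-- The symbol `i sgn(τ)` of the Hilbert transform as an element of `L^∞(ℝ)`. -/
def hilbertSymbol : Lp ℂ ∞ (volume : Measure ℝ) :=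
  hilbertSymbol_memLp.toLp _

/-- The Hilbert transform `H_t` on `L²(ℝ; X)`, with Fourier symbol `i sgn(τ)`: Fourier transform,
multiplication by the symbol, inverse Fourier transform. -/
def hilbertT : L2t X →L[ℂ] L2t X :=
  (Lp.fourierTransformₗᵢ ℝ X).symm.toContinuousLinearEquiv.toContinuousLinearMap ∘L
    (ContinuousLinearMap.lsmul ℂ ℂ : ℂ →L[ℂ] X →L[ℂ] X).holderL volume ∞ 2 2 hilbertSymbol ∘L
    (Lp.fourierTransformₗᵢ ℝ X).toContinuousLinearEquiv.toContinuousLinearMap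

lemma fourier_hilbertT (u : L2t X) :
    ∀ᵐ ξ : ℝ, 𝓕 (hilbertT u) ξ = (Complex.I * ((Real.sign ξ : ℝ) : ℂ)) • 𝓕 u ξ := by
  have h : 𝓕 (hilbertT u) =
      (ContinuousLinearMap.lsmul ℂ ℂ : ℂ →L[ℂ] X →L[ℂ] X).holder 2 hilbertSymbol (𝓕 u) :=
    (Lp.fourierTransformₗᵢ ℝ X).apply_symm_apply _
  rw [h]
  filter_upwards [ContinuousLinearMap.coeFn_holder (r := 2)
    (ContinuousLinearMap.lsmul ℂ ℂ : ℂ →L[ℂ] X →L[ℂ] X) hilbertSymbol (𝓕 u),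
    MemLp.coeFn_toLp (μ := (volume : Measure ℝ)) hilbertSymbol_memLp] with ξ h1 h2
  rw [h1]
  unfold hilbertSymbol
  rw [h2]
  simp

/-- `H_t` maps `H^{1/2}(ℝ; X)` to itself and commutes with `D_t^{1/2}`. -/
lemma IsHalfDeriv.hilbertT_comm {u g : L2t X} (h : IsHalfDeriv u g) :
    IsHalfDeriv (hilbertT u) (hilbertT g) := by
  unfold IsHalfDeriv at *
  filter_upwards [h, fourier_hilbertT u, fourier_hilbertT g] with ξ h1 h2 h3
  rw [h3, h2, h1, smul_comm]

lemma IsHalfDeriv.zero : IsHalfDeriv (0 : L2t X) 0 := by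
  have h : (𝓕 (0 : L2t X)) = 0 := (Lp.fourierTransformₗᵢ ℝ X).map_zero
  unfold IsHalfDeriv
  rw [h]
  filter_upwards [Lp.coeFn_zero X 2 (volume : Measure ℝ)] with ξ h1
  rw [h1, Pi.zero_apply, smul_zero]

lemma IsHalfDeriv.add {u g v k : L2t X} (h : IsHalfDeriv u g) (h' : IsHalfDeriv v k) :
    IsHalfDeriv (u + v) (g + k) := by
  unfold IsHalfDeriv at *
  rw [FourierTransform.fourier_add, FourierTransform.fourier_add]
  filter_upwards [h, h', Lp.coeFn_add (𝓕 g) (𝓕 k), Lp.coeFn_add (𝓕 u) (𝓕 v)] with ξ h1 h2 h3 h4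
  rw [h3, h4, Pi.add_apply, Pi.add_apply, h1, h2, smul_add]

lemma IsHalfDeriv.smul {u g : L2t X} (c : ℂ) (h : IsHalfDeriv u g) :
    IsHalfDeriv (c • u) (c • g) := by
  unfold IsHalfDeriv at *
  rw [FourierTransform.fourier_smul, FourierTransform.fourier_smul]
  filter_upwards [h, Lp.coeFn_smul c (𝓕 g), Lp.coeFn_smul c (𝓕 u)] with ξ h1 h3 h4
  rw [h3, h4, Pi.smul_apply, Pi.smul_apply, h1, smul_comm]

end Fourier

section Energy

variable {n : ℕ} {Ω : Set (EuclideanSpace ℝ (Fin n))} (V : Submodule ℂ (L2pair Ω))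

/-- The energy space `E = H^{1/2}(ℝ; H) ∩ L²(ℝ; V)`. A function `u ∈ L²(ℝ; V)` with
`D_t^{1/2} u ∈ L²(ℝ; H)` is represented by the pair `(u, D_t^{1/2} u)`, whose second entry is
determined by the first one, and the norm inherited from the product is
`‖u‖_E² = ∫ ‖u(t)‖² + ‖∇_V u(t)‖² + ‖D_t^{1/2} u(t)‖² dt`. -/
def energySubmodule : Submodule ℂ (WithLp 2 (L2t (FormSpace V) × L2t (L2 Ω))) where
  carrier := {p | IsHalfDeriv ((emb V).compLpL 2 volume p.fst) p.snd}
  add_mem' := by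
    intro p q hp hq
    have h := IsHalfDeriv.add hp hq
    rw [← map_add] at h
    exact h
  zero_mem' := by
    have h := IsHalfDeriv.zero (X := L2 Ω)
    rw [← map_zero ((emb V).compLpL 2 (volume : Measure ℝ))] at h
    exact h
  smul_mem' := by
    intro c p hp
    have h := IsHalfDeriv.smul c hp
    rw [← map_smul] at h
    exact h

/-- The energy space as a type. -/
def EnergySpace : Type := energySubmodule V

instance : NormedAddCommGroup (EnergySpace V) :=
  inferInstanceAs (NormedAddCommGroup (energySubmodule V))

instance : InnerProductSpace ℂ (EnergySpace V) :=
  inferInstanceAs (InnerProductSpace ℂ (energySubmodule V))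

/-- The inclusion of `E`, which is `u ↦ (u, D_t^{1/2} u)`. -/
def energyIncl : EnergySpace V →L[ℂ] WithLp 2 (L2t (FormSpace V) × L2t (L2 Ω)) :=
  (energySubmodule V).subtypeL

/-- `u ∈ E` as an element of `L²(ℝ; V)`. -/
def toL2V : EnergySpace V →L[ℂ] L2t (FormSpace V) :=
  (WithLp.fstL 2 ℂ (L2t (FormSpace V)) (L2t (L2 Ω))).comp (energyIncl V)

/-- `u ∈ E` as an element of `L²(ℝ; H)`. -/
def toL2H : EnergySpace V →L[ℂ] L2t (L2 Ω) :=
  ((emb V).compLpL 2 volume).comp (toL2V V)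

/-- `D_t^{1/2} u ∈ L²(ℝ; H)` for `u ∈ E`. -/
def halfDeriv : EnergySpace V →L[ℂ] L2t (L2 Ω) :=
  (WithLp.sndL 2 ℂ (L2t (FormSpace V)) (L2t (L2 Ω))).comp (energyIncl V)

end Energy

/-! ### Pairings of square integrable functions -/

lemma integrable_norm_mul_norm {α X Y : Type*} [MeasurableSpace α] {μ : Measure α}
    [NormedAddCommGroup X] [NormedAddCommGroup Y] (f : Lp X 2 μ) (g : Lp Y 2 μ) :
    Integrable (fun t => ‖f t‖ * ‖g t‖) μ :=
  MemLp.integrable_mul (p := 2) (q := 2) (Lp.memLp f).norm (Lp.memLp g).norm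

lemma integral_norm_mul_norm_le {α X Y : Type*} [MeasurableSpace α] {μ : Measure α}
    [NormedAddCommGroup X] [NormedAddCommGroup Y] (f : Lp X 2 μ) (g : Lp Y 2 μ) :
    ∫ t, ‖f t‖ * ‖g t‖ ∂μ ≤ ‖f‖ * ‖g‖ := by
  have h1 := L2.inner_def (𝕜 := ℝ) (Lp.memLp f).norm.toLp (Lp.memLp g).norm.toLp
  have h2 : ‖inner ℝ (Lp.memLp f).norm.toLp (Lp.memLp g).norm.toLp‖ ≤ ‖f‖ * ‖g‖ := by
    refine (norm_inner_le_norm _ _).trans (le_of_eq ?_)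
    rw [Lp.norm_toLp, Lp.norm_toLp, eLpNorm_norm, eLpNorm_norm, Lp.norm_def, Lp.norm_def]
  rw [h1] at h2
  refine le_trans (le_of_eq ?_) ((le_abs_self _).trans h2)
  refine integral_congr_ae ?_
  filter_upwards [(Lp.memLp f).norm.coeFn_toLp, (Lp.memLp g).norm.coeFn_toLp] with t ht ht'
  simp [ht, ht', mul_comm]

/-- Compositions `t ↦ F t (u t)` of Carathéodory functions are measurable. -/
lemma aestronglyMeasurable_caratheodory {X : Type*} [NormedAddCommGroup X] {μ : Measure ℝ}
    {F : ℝ → X → ℂ} (hF : ∀ c, AEStronglyMeasurable (fun t => F t c) μ)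
    (hc : ∀ᵐ t ∂μ, Continuous (F t)) {u : ℝ → X} (hu : AEStronglyMeasurable u μ) :
    AEStronglyMeasurable (fun t => F t (u t)) μ := by
  obtain ⟨v, hv, huv⟩ := hu
  suffices h : AEStronglyMeasurable (fun t => F t (v t)) μ by
    refine h.congr ?_
    filter_upwards [huv] with t ht
    rw [ht]
  have hs : ∀ s : SimpleFunc ℝ X, AEStronglyMeasurable (fun t => F t (s t)) μ := by
    intro s
    have : (fun t => F t (s t)) =
        fun t => ∑ c ∈ s.range, (s ⁻¹' {c}).indicator (fun t => F t c) t := by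
      funext t
      rw [Finset.sum_eq_single (s t)]
      · simp
      · intro b _ hb
        exact Set.indicator_of_notMem (by simpa using hb.symm) _
      · intro h
        exact absurd (s.mem_range_self t) h
    rw [this]
    exact Finset.aestronglyMeasurable_fun_sum _ fun c _ =>
      (hF c).indicator (s.measurableSet_fiber c)
  refine aestronglyMeasurable_of_tendsto_ae Filter.atTop (fun k => hs (hv.approx k)) ?_
  filter_upwards [hc] with t ht
  exact (ht.tendsto _).comp (hv.tendsto_approx t)

lemma continuous_antiDual_apply {X : Type*} [NormedAddCommGroup X] [NormedSpace ℂ X] :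
    Continuous (fun p : AntiDual X × X => p.1 p.2) := by
  rw [continuous_iff_continuousAt]
  rintro ⟨f, x⟩
  rw [ContinuousAt, tendsto_iff_norm_sub_tendsto_zero]
  have h : Filter.Tendsto (fun p : AntiDual X × X => ‖p.1 - f‖ * ‖p.2‖ + ‖f‖ * ‖p.2 - x‖)
      (nhds (f, x)) (nhds 0) := by
    have hc : Continuous (fun p : AntiDual X × X => ‖p.1 - f‖ * ‖p.2‖ + ‖f‖ * ‖p.2 - x‖) := by
      fun_prop
    have := hc.tendsto (f, x)
    simpa using this
  refine squeeze_zero (fun _ => norm_nonneg _) (fun p => ?_) h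
  have e : p.1 p.2 - f x = (p.1 - f) p.2 + f (p.2 - x) := by
    simp
  rw [e]
  exact (norm_add_le _ _).trans (add_le_add ((p.1 - f).le_opNorm _) (f.le_opNorm _))

lemma integrable_antiDual_apply {X : Type*} [NormedAddCommGroup X] [NormedSpace ℂ X]
    (f : L2t (AntiDual X)) (w : L2t X) :
    Integrable (fun t => f t (w t)) ∧ ‖∫ t, f t (w t)‖ ≤ ‖f‖ * ‖w‖ := by
  have hbd : ∀ t : ℝ, ‖f t (w t)‖ ≤ ‖f t‖ * ‖w t‖ := fun t => (f t).le_opNorm _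
  have hint := integrable_norm_mul_norm f w
  refine ⟨hint.mono' (continuous_antiDual_apply.comp_aestronglyMeasurable
    ((Lp.aestronglyMeasurable f).prodMk (Lp.aestronglyMeasurable w)))
    (Filter.Eventually.of_forall hbd), ?_⟩
  exact (norm_integral_le_of_norm_le hint (Filter.Eventually.of_forall hbd)).trans
    (integral_norm_mul_norm_le f w)

/-! ### The non-autonomous form and the parabolic operator -/

/-- The coefficients `A : ℝ × Ω → ℂⁿˣⁿ` are measurable, bounded and coercive with constants
`lam` and `Lam`. -/
structure IsElliptic {n : ℕ} (Ω : Set (EuclideanSpace ℝ (Fin n)))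
    (A : ℝ → EuclideanSpace ℝ (Fin n) → Matrix (Fin n) (Fin n) ℂ) (lam Lam : ℝ) : Prop where
  measurable : ∀ i j, AEMeasurable (fun p : ℝ × EuclideanSpace ℝ (Fin n) => A p.1 p.2 i j)
    ((volume : Measure ℝ).prod (volume.restrict Ω))
  coercive : ∀ t : ℝ, ∀ᵐ x ∂(volume.restrict Ω), ∀ ξ : EuclideanSpace ℂ (Fin n),
    lam * ‖ξ‖ ^ 2 ≤ ((A t x).mulVec ξ ⬝ᵥ star (ξ : Fin n → ℂ)).re
  bounded : ∀ t : ℝ, ∀ᵐ x ∂(volume.restrict Ω), ∀ ξ ζ : EuclideanSpace ℂ (Fin n),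
    ‖(A t x).mulVec ξ ⬝ᵥ (ζ : Fin n → ℂ)‖ ≤ Lam * ‖ξ‖ * ‖ζ‖

section Operator

variable {n : ℕ} {Ω : Set (EuclideanSpace ℝ (Fin n))} (V : Submodule ℂ (L2pair Ω))
  {A : ℝ → EuclideanSpace ℝ (Fin n) → Matrix (Fin n) (Fin n) ℂ} {lam Lam : ℝ}

/-- The sesquilinear form `a(v, w) = ∫_Ω B(x) ∇v(x) · conj(∇w(x)) dx = ⟨𝔄 v, w⟩` on `V` for a matrix
function `B` on `Ω`. -/
def form (B : EuclideanSpace ℝ (Fin n) → Matrix (Fin n) (Fin n) ℂ) (v w : FormSpace V) : ℂ :=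
  ∫ x in Ω, (B x).mulVec (grad V v x) ⬝ᵥ star (grad V w x : Fin n → ℂ)

lemma form_integrand {B : EuclideanSpace ℝ (Fin n) → Matrix (Fin n) (Fin n) ℂ}
    (hm : ∀ i j, AEMeasurable (fun x => B x i j) (volume.restrict Ω))
    (hb : ∀ᵐ x ∂(volume.restrict Ω), ∀ ξ ζ : EuclideanSpace ℂ (Fin n),
      ‖(B x).mulVec ξ ⬝ᵥ (ζ : Fin n → ℂ)‖ ≤ Lam * ‖ξ‖ * ‖ζ‖) (v w : FormSpace V) :
    (∀ᵐ x ∂(volume.restrict Ω), ‖(B x).mulVec (grad V v x) ⬝ᵥ star (grad V w x : Fin n → ℂ)‖ ≤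
      Lam * (‖grad V v x‖ * ‖grad V w x‖)) ∧
    Integrable (fun x => (B x).mulVec (grad V v x) ⬝ᵥ star (grad V w x : Fin n → ℂ))
      (volume.restrict Ω) := by
  have h1 : ∀ᵐ x ∂(volume.restrict Ω),
      ‖(B x).mulVec (grad V v x) ⬝ᵥ star (grad V w x : Fin n → ℂ)‖ ≤
      Lam * (‖grad V v x‖ * ‖grad V w x‖) := by
    filter_upwards [hb] with x hx
    have h := hx (grad V v x) (WithLp.toLp 2 (star (grad V w x : Fin n → ℂ)))
    have hn : ‖WithLp.toLp 2 (star (grad V w x : Fin n → ℂ))‖ = ‖grad V w x‖ := by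
      simp [EuclideanSpace.norm_eq]
    rw [hn, mul_assoc] at h
    exact h
  refine ⟨h1, ((integrable_norm_mul_norm (grad V v) (grad V w)).const_mul Lam).mono' ?_ h1⟩
  have hc : ∀ (u : FormSpace V) (i : Fin n),
      AEMeasurable (fun x => grad V u x i) (volume.restrict Ω) := by
    intro u i
    exact (EuclideanSpace.proj (𝕜 := ℂ) i).continuous.measurable.comp_aemeasurable
      (Lp.aestronglyMeasurable (grad V u)).aemeasurable
  refine AEMeasurable.aestronglyMeasurable ?_
  simp only [dotProduct, Matrix.mulVec, Pi.star_apply]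
  refine Finset.aemeasurable_fun_sum _ fun i _ => ?_
  refine (Finset.aemeasurable_fun_sum _ fun j _ => (hm i j).mul (hc v j)).mul ?_
  exact continuous_star.measurable.comp_aemeasurable (hc w i)

lemma form_bounded {B : EuclideanSpace ℝ (Fin n) → Matrix (Fin n) (Fin n) ℂ}
    (hm : ∀ i j, AEMeasurable (fun x => B x i j) (volume.restrict Ω))
    (hb : ∀ᵐ x ∂(volume.restrict Ω), ∀ ξ ζ : EuclideanSpace ℂ (Fin n),
      ‖(B x).mulVec ξ ⬝ᵥ (ζ : Fin n → ℂ)‖ ≤ Lam * ‖ξ‖ * ‖ζ‖) (hL : 0 ≤ Lam) :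
    ∃ b : FormSpace V →L[ℂ] FormSpace V →L⋆[ℂ] ℂ, (∀ v w, b v w = form V B v w) ∧
      ∀ v w, ‖b v w‖ ≤ Lam * ‖v‖ * ‖w‖ := by
  have hbd : ∀ v w : FormSpace V, ‖form V B v w‖ ≤ Lam * ‖v‖ * ‖w‖ := by
    intro v w
    have hg : ∀ u : FormSpace V, ‖grad V u‖ ≤ ‖u‖ := fun u => WithLp.norm_snd_le _ _
    calc ‖form V B v w‖
        ≤ ∫ x in Ω, Lam * (‖grad V v x‖ * ‖grad V w x‖) :=
          norm_integral_le_of_norm_le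
            ((integrable_norm_mul_norm (grad V v) (grad V w)).const_mul Lam)
            (form_integrand V hm hb v w).1
      _ ≤ Lam * (‖grad V v‖ * ‖grad V w‖) := by
          rw [integral_const_mul]
          exact mul_le_mul_of_nonneg_left (integral_norm_mul_norm_le _ _) hL
      _ ≤ Lam * ‖v‖ * ‖w‖ := by
          rw [mul_assoc]
          gcongr
          · exact hg v
          · exact hg w
  refine ⟨LinearMap.mkContinuous₂ (LinearMap.mk₂'ₛₗ (RingHom.id ℂ) (starRingEnd ℂ)
    (form V B) ?_ ?_ ?_ ?_) Lam hbd, fun v w => rfl, hbd⟩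
  · intro v v' w
    unfold form
    rw [← integral_add (form_integrand V hm hb v w).2 (form_integrand V hm hb v' w).2]
    refine integral_congr_ae ?_
    rw [map_add]
    filter_upwards [Lp.coeFn_add (grad V v) (grad V v')] with x hx
    rw [hx, Pi.add_apply, WithLp.ofLp_add, Matrix.mulVec_add, add_dotProduct]
  · intro c v w
    unfold form
    rw [RingHom.id_apply, smul_eq_mul, ← integral_const_mul]
    refine integral_congr_ae ?_
    rw [map_smul]
    filter_upwards [Lp.coeFn_smul c (grad V v)] with x hx
    rw [hx, Pi.smul_apply, WithLp.ofLp_smul, Matrix.mulVec_smul, smul_dotProduct, smul_eq_mul]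
  · intro v w w'
    unfold form
    rw [← integral_add (form_integrand V hm hb v w).2 (form_integrand V hm hb v w').2]
    refine integral_congr_ae ?_
    rw [map_add]
    filter_upwards [Lp.coeFn_add (grad V w) (grad V w')] with x hx
    rw [hx, Pi.add_apply, WithLp.ofLp_add, star_add, dotProduct_add]
  · intro c v w
    unfold form
    rw [smul_eq_mul, ← integral_const_mul]
    refine integral_congr_ae ?_
    rw [map_smul]
    filter_upwards [Lp.coeFn_smul c (grad V w)] with x hx
    rw [hx, Pi.smul_apply, WithLp.ofLp_smul, star_smul, dotProduct_smul, smul_eq_mul]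
    rfl

/-- For almost every `t` the form `a(t, ·, ·)` is sesquilinear and bounded. -/
lemma form_time_bounded (hA : IsElliptic Ω A lam Lam) (hL : 0 ≤ Lam) :
    ∀ᵐ t : ℝ, ∃ b : FormSpace V →L[ℂ] FormSpace V →L⋆[ℂ] ℂ, (∀ v w, b v w = form V (A t) v w) ∧
      ∀ v w, ‖b v w‖ ≤ Lam * ‖v‖ * ‖w‖ := by
  have h : ∀ᵐ t : ℝ, ∀ i j, AEMeasurable (fun x => A t x i j) (volume.restrict Ω) := by
    rw [ae_all_iff]
    intro i
    rw [ae_all_iff]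
    intro j
    filter_upwards [(hA.measurable i j).aestronglyMeasurable.prodMk_left] with t ht
    exact ht.aemeasurable
  filter_upwards [h] with t ht
  exact form_bounded V ht (hA.bounded t) hL

lemma form_time_integrable (hA : IsElliptic Ω A lam Lam) (hL : 0 ≤ Lam) (u w : L2t (FormSpace V)) :
    Integrable (fun t => form V (A t) (u t) (w t)) ∧
      ‖∫ t, form V (A t) (u t) (w t)‖ ≤ Lam * ‖u‖ * ‖w‖ := by
  have hbd : ∀ᵐ t : ℝ, ‖form V (A t) (u t) (w t)‖ ≤ Lam * (‖u t‖ * ‖w t‖) := by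
    filter_upwards [form_time_bounded V hA hL] with t ht
    obtain ⟨b, hb, hb'⟩ := ht
    rw [← hb, ← mul_assoc]
    exact hb' _ _
  have hmeas : AEStronglyMeasurable (fun t => form V (A t) (u t) (w t)) volume := by
    refine aestronglyMeasurable_caratheodory (X := FormSpace V × FormSpace V)
      (F := fun t p => form V (A t) p.1 p.2) (u := fun t => (u t, w t)) ?_ ?_
      ((Lp.aestronglyMeasurable u).prodMk (Lp.aestronglyMeasurable w))
    · rintro ⟨v, z⟩
      refine AEStronglyMeasurable.integral_prod_right'
        (f := fun p : ℝ × EuclideanSpace ℝ (Fin n) =>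
          (A p.1 p.2).mulVec (grad V v p.2) ⬝ᵥ star (grad V z p.2 : Fin n → ℂ)) ?_
      have hc : ∀ (u : FormSpace V) (i : Fin n),
          AEMeasurable (fun p : ℝ × EuclideanSpace ℝ (Fin n) => grad V u p.2 i)
            ((volume : Measure ℝ).prod (volume.restrict Ω)) := by
        intro u i
        exact (EuclideanSpace.proj (𝕜 := ℂ) i).continuous.measurable.comp_aemeasurable
          (Lp.aestronglyMeasurable (grad V u)).comp_snd.aemeasurable
      refine AEMeasurable.aestronglyMeasurable ?_
      simp only [dotProduct, Matrix.mulVec, Pi.star_apply]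
      refine Finset.aemeasurable_fun_sum _ fun i _ => ?_
      refine (Finset.aemeasurable_fun_sum _ fun j _ =>
        (hA.measurable i j).mul (hc v j)).mul ?_
      exact continuous_star.measurable.comp_aemeasurable (hc z i)
    · filter_upwards [form_time_bounded V hA hL] with t ht
      obtain ⟨b, hb, -⟩ := ht
      have : (fun p : FormSpace V × FormSpace V => form V (A t) p.1 p.2) = fun p => b p.1 p.2 := by
        funext p
        rw [hb]
      rw [this]
      exact continuous_antiDual_apply.comp
        ((b.continuous.comp continuous_fst).prodMk continuous_snd)
  have hint := (integrable_norm_mul_norm u w).const_mul Lam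
  refine ⟨hint.mono' hmeas hbd, (norm_integral_le_of_norm_le hint hbd).trans ?_⟩
  rw [integral_const_mul, mul_assoc]
  exact mul_le_mul_of_nonneg_left (integral_norm_mul_norm_le _ _) hL

/-- The integrand in the definition of the parabolic operator is integrable. -/
lemma parabolic_integrable (hA : IsElliptic Ω A lam Lam) (hL : 0 ≤ Lam)
    (u w : EnergySpace V) :
    Integrable (fun t => -inner ℂ (hilbertT (halfDeriv V w) t) (halfDeriv V u t) +
      form V (A t) (toL2V V u t) (toL2V V w t)) :=
  (L2.integrable_inner (𝕜 := ℂ) (hilbertT (halfDeriv V w)) (halfDeriv V u)).neg.add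
    (form_time_integrable V hA hL (toL2V V u) (toL2V V w)).1

/-- The parabolic operator `𝔏 : E → E*`,
`𝔏(u)(w) = ∫ -(D_t^{1/2} u | D_t^{1/2} H_t w)_H + ⟨𝔄(t) u(t), w(t)⟩ dt`,
where `D_t^{1/2} H_t w = H_t D_t^{1/2} w`. It extends `u ↦ u' + 𝔄 u`. -/
def parabolicOp (hA : IsElliptic Ω A lam Lam) (hL : 0 ≤ Lam) :
    EnergySpace V →L[ℂ] AntiDual (EnergySpace V) :=
  LinearMap.mkContinuous₂ (LinearMap.mk₂'ₛₗ (RingHom.id ℂ) (starRingEnd ℂ)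
    (fun u w : EnergySpace V =>
      ∫ t, (-inner ℂ (hilbertT (halfDeriv V w) t) (halfDeriv V u t) +
        form V (A t) (toL2V V u t) (toL2V V w t)))
    (by
      intro u u' w
      rw [← integral_add (parabolic_integrable V hA hL u w) (parabolic_integrable V hA hL u' w)]
      refine integral_congr_ae ?_
      rw [map_add, map_add]
      filter_upwards [form_time_bounded V hA hL, Lp.coeFn_add (toL2V V u) (toL2V V u'),
        Lp.coeFn_add (halfDeriv V u) (halfDeriv V u')] with t ht h1 h2
      obtain ⟨b, hb, -⟩ := ht
      rw [h1, h2, Pi.add_apply, Pi.add_apply, inner_add_right]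
      simp only [← hb, map_add, add_apply]
      ring)
    (by
      intro c u w
      rw [RingHom.id_apply, smul_eq_mul, ← integral_const_mul]
      refine integral_congr_ae ?_
      rw [map_smul, map_smul]
      filter_upwards [form_time_bounded V hA hL, Lp.coeFn_smul c (toL2V V u),
        Lp.coeFn_smul c (halfDeriv V u)] with t ht h1 h2
      obtain ⟨b, hb, -⟩ := ht
      rw [h1, h2, Pi.smul_apply, Pi.smul_apply, inner_smul_right]
      simp only [← hb, map_smul, smul_apply, smul_eq_mul]
      ring)
    (by
      intro u w w'
      rw [← integral_add (parabolic_integrable V hA hL u w) (parabolic_integrable V hA hL u w')]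
      refine integral_congr_ae ?_
      rw [map_add, map_add, map_add]
      filter_upwards [form_time_bounded V hA hL, Lp.coeFn_add (toL2V V w) (toL2V V w'),
        Lp.coeFn_add (hilbertT (halfDeriv V w)) (hilbertT (halfDeriv V w'))] with t ht h1 h2
      obtain ⟨b, hb, -⟩ := ht
      rw [h1, h2, Pi.add_apply, Pi.add_apply, inner_add_left]
      simp only [← hb, map_add]
      ring)
    (by
      intro c u w
      rw [smul_eq_mul, ← integral_const_mul]
      refine integral_congr_ae ?_
      rw [map_smul, map_smul, map_smul]
      filter_upwards [form_time_bounded V hA hL, Lp.coeFn_smul c (toL2V V w),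
        Lp.coeFn_smul c (hilbertT (halfDeriv V w))] with t ht h1 h2
      obtain ⟨b, hb, -⟩ := ht
      rw [h1, h2, Pi.smul_apply, Pi.smul_apply, inner_smul_left]
      simp only [← hb, map_smulₛₗ, smul_eq_mul]
      ring))
    (‖(hilbertT : L2t (L2 Ω) →L[ℂ] L2t (L2 Ω))‖ + Lam)
    (by
      intro u w
      have hV : ∀ v : EnergySpace V, ‖toL2V V v‖ ≤ ‖v‖ := fun v => WithLp.norm_fst_le _ _
      have hD : ∀ v : EnergySpace V, ‖halfDeriv V v‖ ≤ ‖v‖ := fun v => WithLp.norm_snd_le _ _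
      have h1 : ‖inner ℂ (hilbertT (halfDeriv V w)) (halfDeriv V u)‖ ≤
          ‖(hilbertT : L2t (L2 Ω) →L[ℂ] L2t (L2 Ω))‖ * ‖u‖ * ‖w‖ := by
        refine (norm_inner_le_norm _ _).trans ?_
        calc _ ≤ (‖(hilbertT : L2t (L2 Ω) →L[ℂ] L2t (L2 Ω))‖ * ‖w‖) * ‖u‖ := by
              gcongr
              · exact (hilbertT.le_opNorm _).trans
                  (mul_le_mul_of_nonneg_left (hD w) (norm_nonneg _))
              · exact hD u
          _ = _ := by ring
      have h2 : ‖∫ t, form V (A t) (toL2V V u t) (toL2V V w t)‖ ≤ Lam * ‖u‖ * ‖w‖ := by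
        refine (form_time_integrable V hA hL (toL2V V u) (toL2V V w)).2.trans ?_
        gcongr
        · exact hV u
        · exact hV w
      have h3 : ∫ t, (-inner ℂ (hilbertT (halfDeriv V w) t) (halfDeriv V u t) +
          form V (A t) (toL2V V u t) (toL2V V w t)) =
          -inner ℂ (hilbertT (halfDeriv V w)) (halfDeriv V u) +
          ∫ t, form V (A t) (toL2V V u t) (toL2V V w t) := by
        rw [L2.inner_def, ← integral_neg]
        exact integral_add
          (L2.integrable_inner (𝕜 := ℂ) (hilbertT (halfDeriv V w)) (halfDeriv V u)).neg
          (form_time_integrable V hA hL (toL2V V u) (toL2V V w)).1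
      rw [LinearMap.mk₂'ₛₗ_apply, h3]
      refine (norm_add_le _ _).trans ?_
      rw [norm_neg, add_mul, add_mul]
      exact add_le_add h1 h2)

/-- The embedding `L²(ℝ; V*) → E*`, which sends `f` to `w ↦ ∫ ⟨f(t), w(t)⟩ dt`. -/
def dualEmb : L2t (AntiDual (FormSpace V)) →L[ℂ] AntiDual (EnergySpace V) :=
  LinearMap.mkContinuous₂ (LinearMap.mk₂'ₛₗ (RingHom.id ℂ) (starRingEnd ℂ)
    (fun (f : L2t (AntiDual (FormSpace V))) (w : EnergySpace V) => ∫ t, f t (toL2V V w t))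
    (by
      intro f g w
      rw [← integral_add (integrable_antiDual_apply f (toL2V V w)).1
        (integrable_antiDual_apply g (toL2V V w)).1]
      refine integral_congr_ae ?_
      filter_upwards [Lp.coeFn_add f g] with t h1
      rw [h1]
      rfl)
    (by
      intro c f w
      rw [RingHom.id_apply, smul_eq_mul, ← integral_const_mul]
      refine integral_congr_ae ?_
      filter_upwards [Lp.coeFn_smul c f] with t h1
      rw [h1]
      rfl)
    (by
      intro f w w'
      rw [← integral_add (integrable_antiDual_apply f (toL2V V w)).1
        (integrable_antiDual_apply f (toL2V V w')).1]
      refine integral_congr_ae ?_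
      rw [map_add]
      filter_upwards [Lp.coeFn_add (toL2V V w) (toL2V V w')] with t h1
      rw [h1, Pi.add_apply, map_add])
    (by
      intro c f w
      rw [smul_eq_mul, ← integral_const_mul]
      refine integral_congr_ae ?_
      rw [map_smul]
      filter_upwards [Lp.coeFn_smul c (toL2V V w)] with t h1
      rw [h1, Pi.smul_apply, map_smulₛₗ, smul_eq_mul]))
    1
    (by
      intro f w
      refine (integrable_antiDual_apply f (toL2V V w)).2.trans ?_
      rw [one_mul]
      exact mul_le_mul_of_nonneg_left (WithLp.norm_fst_le _ _) (norm_nonneg _))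

/-- The embedding `L²(ℝ; H) → L²(ℝ; V*)` induced by `H → V*`. -/
def embDualT : L2t (L2 Ω) →L[ℂ] L2t (AntiDual (FormSpace V)) :=
  (embDual V).compLpL 2 volume

/-- The operator `θ + 𝔏 : E → E*`, where `θ u ∈ E*` is the functional
`w ↦ ∫ (θ u(t) | w(t))_H dt`. -/
def shiftedOp (hA : IsElliptic Ω A lam Lam) (hL : 0 ≤ Lam) (θ : ℂ) :
    EnergySpace V →L[ℂ] AntiDual (EnergySpace V) :=
  θ • ((dualEmb V).comp ((embDualT V).comp (toL2H V))) + parabolicOp V hA hL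

/-- `u ∈ H¹(ℝ; V*) ∩ L²(ℝ; V)` solves `u'(t) + θ u(t) + 𝔄(t) u(t) = f(t)` as an equality in `V*`
for almost every `t ∈ ℝ`. -/
def IsSolution (A : ℝ → EuclideanSpace ℝ (Fin n) → Matrix (Fin n) (Fin n) ℂ) (θ : ℂ)
    (f : L2t (AntiDual (FormSpace V))) (u : L2t (FormSpace V)) : Prop :=
  ∃ u' : L2t (AntiDual (FormSpace V)),
    HasWeakDeriv (embDualT V ((emb V).compLpL 2 volume u)) u' ∧
    ∀ᵐ t : ℝ, ∀ w : FormSpace V,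
      u' t w + θ * inner ℂ (emb V w) (emb V (u t)) + form V (A t) (u t) w = f t w

end Operator

/-! ### Maximal accretive operators -/

/-- A linear operator `T` with domain in a Hilbert space is accretive if `Re (T u | u) ≥ 0`. -/
def IsAccretive {X : Type*} [NormedAddCommGroup X] [InnerProductSpace ℂ X] (T : X →ₗ.[ℂ] X) : Prop :=
  ∀ u : T.domain, 0 ≤ (inner ℂ (u : X) (T u)).re

/-- `T` is maximal accretive: it is densely defined and accretive, `z + T` is invertible with
`‖(z + T)⁻¹‖ ≤ 1 / Re z` whenever `Re z > 0`, and `T` has no proper accretive extension. -/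
structure IsMaximalAccretive {X : Type*} [NormedAddCommGroup X] [InnerProductSpace ℂ X]
    (T : X →ₗ.[ℂ] X) : Prop where
  dense_domain : Dense (T.domain : Set X)
  accretive : IsAccretive T
  resolvent : ∀ z : ℂ, 0 < z.re → ∀ f : X, ∃! u : T.domain, z • (u : X) + T u = f
  resolvent_bound : ∀ z : ℂ, 0 < z.re → ∀ u : T.domain, ‖(u : X)‖ ≤ ‖z • (u : X) + T u‖ / z.re
  maximal : ∀ S : X →ₗ.[ℂ] X, IsAccretive S → T ≤ S → S = T

end NonAuto

end

/-!
Everything rests on the *hidden coercivity* of `θ + 𝔏`. The Hilbert transform `H_t` is a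
skew-adjoint isometry with `H_t² = -1` that acts on the energy space and commutes with `∇_V` and
`D_t^{1/2}`. Tested with `u`, the time part of `𝔏` is purely imaginary and only
`Re θ ‖u‖² + λ ‖∇u‖²` is left. Tested with `H_t u`, it gives `‖D_t^{1/2} u‖²`, up to the errors
`|Im θ| ‖u‖²` and `Λ ‖∇u‖²`. Hence `w = u + δ H_t u` with
`1/δ = max {(Λ + 1)/λ, (|Im θ| + 1)/Re θ}` satisfies `Re ((θ + 𝔏) u)(w) ≥ δ ‖u‖²`
(`shiftedOp_hidden_coercivity`). Here `δ ≤ 1` because of `λ ≤ Λ`, so `‖w‖ ≤ √2 ‖u‖`, and since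
`1 + δ H_t` is invertible, a Lax–Milgram argument (`existsUnique_and_norm_le_of_coercive`) gives
unique solvability with the stated bound. For data `f` in `L²(ℝ; H)`, testing with `u` itself
gives `Re θ ‖u‖ ≤ ‖f‖`.

The equation in the energy space is compared with the pointwise one in `V*` on the Fourier side
(`isSolution_iff`). Let `S = emb* emb` on `V`; it represents `V → H → V*` after the Riesz
identification of `V*` with `V`. Both equations say that a certain `q ∈ L²(ℝ; V)`, the Riesz
representative of `f - θ u - 𝔄 u`, satisfies `q̂ = iτ S û` almost everywhere. For the weak derivative
this is `hasWeakDeriv_iff_fourier`. For the form `-(D_t^{1/2} u | H_t D_t^{1/2} w)` it is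
`fourier_eq_iff_exists_halfDeriv`, which also yields `D_t^{1/2} u ∈ L²(ℝ; H)` from
`|τ| ‖û‖_H² = |(q̂ | û)_V|`; thus solutions in `H¹(ℝ; V*) ∩ L²(ℝ; V)` lie in the energy space.

The part of `𝔏` in `L²(ℝ; H)` is single valued because the energy space embeds injectively and
densely into `L²(ℝ; H)`, and its maximal accretivity follows from accretivity and the
surjectivity of `z + 𝔏` (`isMaximalAccretive_of_resolvent`).
-/

namespace NonAuto

noncomputable section

/-! ### Bounded multipliers -/

/-- Multiplication by a bounded function on `L²(ℝ; X)`. -/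
def mulLp {X : Type*} [NormedAddCommGroup X] [InnerProductSpace ℂ X]
    (m : ℝ → ℂ) (hm : MemLp m ∞ (volume : Measure ℝ)) : L2t X →L[ℂ] L2t X :=
  (ContinuousLinearMap.lsmul ℂ ℂ : ℂ →L[ℂ] X →L[ℂ] X).holderL volume ∞ 2 2 (hm.toLp m)

lemma coeFn_mulLp {X : Type*} [NormedAddCommGroup X] [InnerProductSpace ℂ X]
    {m : ℝ → ℂ} (hm : MemLp m ∞ (volume : Measure ℝ)) (u : L2t X) :
    mulLp m hm u =ᵐ[volume] fun ξ => m ξ • u ξ := by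
  filter_upwards [ContinuousLinearMap.coeFn_holder (r := 2)
    (ContinuousLinearMap.lsmul ℂ ℂ : ℂ →L[ℂ] X →L[ℂ] X) (hm.toLp m) u, hm.coeFn_toLp] with ξ h1 h2
  rw [← h2]
  exact h1

/-! ### The Fourier transform on `L²(ℝ; X)` -/

section Fourier

variable {X Y : Type*} [NormedAddCommGroup X] [InnerProductSpace ℂ X] [CompleteSpace X]
  [NormedAddCommGroup Y] [InnerProductSpace ℂ Y] [CompleteSpace Y]

lemma L2t.fourier_injective : Function.Injective (𝓕 : L2t X → L2t X) :=
  (Lp.fourierTransformₗᵢ ℝ X).injective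

lemma fourier_compLpL (T : X →L[ℂ] Y) (u : L2t X) :
    𝓕 (T.compLpL 2 volume u) = T.compLpL 2 volume (𝓕 u) := by
  refine DenseRange.induction_on
    (p := fun u : L2t X => 𝓕 (T.compLpL 2 volume u) = T.compLpL 2 volume (𝓕 u))
    (SchwartzMap.denseRange_toLpCLM (E := ℝ) (F := X) (p := 2) ENNReal.ofNat_ne_top) u ?_ ?_
  · exact isClosed_eq
      ((Lp.fourierTransformₗᵢ ℝ Y).continuous.comp (T.compLpL 2 volume).continuous)
      ((T.compLpL 2 volume).continuous.comp (Lp.fourierTransformₗᵢ ℝ X).continuous)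
  · intro f
    have h : ∀ f : SchwartzMap ℝ X,
        T.compLpL 2 volume (f.toLp 2) = (f.postcompCLM T).toLp 2 := by
      intro f
      refine Lp.ext ?_
      filter_upwards [T.coeFn_compLpL (f.toLp 2), f.coeFn_toLp 2 volume,
        (f.postcompCLM T).coeFn_toLp 2 volume] with x h1 h2 h3
      rw [h1, h2, h3, SchwartzMap.postcompCLM_apply]
    rw [SchwartzMap.toLpCLM_apply, h, SchwartzMap.toLp_fourier_eq, SchwartzMap.toLp_fourier_eq, h]
    congr 1
    ext ξ
    rw [SchwartzMap.postcompCLM_apply, SchwartzMap.fourier_coe, SchwartzMap.fourier_coe,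
      Real.fourier_eq, Real.fourier_eq,
      ← T.integral_comp_comm ((Real.fourierIntegral_convergent_iff ξ).2 f.integrable)]
    simp [SchwartzMap.postcompCLM_apply, Circle.smul_def]

/-- The transposition rule `∫ ψ̂ z = ∫ ψ ẑ` for Schwartz functions `ψ` and `z ∈ L²`. -/
lemma integral_fourier_smul (ψ : SchwartzMap ℝ ℂ) (z : L2t X) :
    ∫ t, (𝓕 ψ) t • z t = ∫ ξ, ψ ξ • 𝓕 z ξ := by
  have h := congrArg (fun D : TemperedDistribution ℝ X => D ψ)
    (Lp.fourier_toTemperedDistribution_eq z)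
  simpa [TemperedDistribution.fourier_apply, Lp.toTemperedDistribution_apply] using h

lemma inner_fourier (u w : L2t X) :
    inner ℂ u w = ∫ ξ, inner ℂ (𝓕 u ξ) (𝓕 w ξ) := by
  rw [← Lp.inner_fourier_eq, L2.inner_def]

/-! ### The Hilbert transform -/

/-- The symbol has modulus one away from the null set `{0}`. -/
lemma norm_hilbertT (u : L2t X) : ‖hilbertT u‖ = ‖u‖ := by
  rw [← Lp.norm_fourier_eq, ← Lp.norm_fourier_eq u]
  refine le_antisymm (Lp.norm_le_norm_of_ae_le ?_) (Lp.norm_le_norm_of_ae_le ?_)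
  all_goals
    filter_upwards [fourier_hilbertT u, Measure.ae_ne volume (0 : ℝ)] with ξ h1 h2
    rw [h1, norm_smul]
    rcases Real.sign_apply_eq_of_ne_zero ξ h2 with h | h <;> simp [h]

lemma hilbertT_hilbertT (u : L2t X) : hilbertT (hilbertT u) = -u := by
  apply L2t.fourier_injective
  have e : 𝓕 (-u) = -𝓕 u := (Lp.fourierTransformₗᵢ ℝ X).map_neg u
  rw [e]
  refine Lp.ext ?_
  filter_upwards [fourier_hilbertT u, fourier_hilbertT (hilbertT u), Lp.coeFn_neg (𝓕 u),
    Measure.ae_ne volume (0 : ℝ)] with ξ h1 h2 h3 h4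
  rw [h2, h1, h3, smul_smul, Pi.neg_apply, ← neg_one_smul ℂ (𝓕 u ξ)]
  congr 1
  rcases Real.sign_apply_eq_of_ne_zero ξ h4 with h | h <;> simp [h]

lemma inner_hilbertT_hilbertT (u w : L2t X) :
    inner ℂ (hilbertT u) (hilbertT w) = inner ℂ u w :=
  (⟨hilbertT.toLinearMap, norm_hilbertT⟩ : L2t X →ₗᵢ[ℂ] L2t X).inner_map_map u w

/-- The Hilbert transform is skew-adjoint, so `(H_t u | u)` is purely imaginary. -/
lemma re_inner_hilbertT_self (u : L2t X) : (inner ℂ (hilbertT u) u).re = 0 := by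
  have h := inner_hilbertT_hilbertT (hilbertT u) u
  rw [hilbertT_hilbertT, inner_neg_left] at h
  have h' := congrArg Complex.re h
  have h'' : (inner ℂ u (hilbertT u)).re = (inner ℂ (hilbertT u) u).re := inner_re_symm (𝕜 := ℂ) _ _
  rw [Complex.neg_re] at h'
  linarith

lemma hilbertT_compLpL (T : X →L[ℂ] Y) (u : L2t X) :
    hilbertT (T.compLpL 2 volume u) = T.compLpL 2 volume (hilbertT u) := by
  apply L2t.fourier_injective
  refine Lp.ext ?_
  rw [fourier_compLpL]
  filter_upwards [fourier_hilbertT u, fourier_hilbertT (T.compLpL 2 volume u),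
    T.coeFn_compLpL (𝓕 (hilbertT u)), T.coeFn_compLpL (𝓕 u)] with ξ h1 h2 h3 h4
  rw [h2, h3, fourier_compLpL, h4, h1, map_smul]

/-! ### Half derivatives -/

/-- The graph of `D_t^{1/2}` is closed. Dividing the relation between the Fourier transforms by
`1 + |τ|^{1/2}` turns it into one between bounded multipliers. -/
lemma isClosed_setOf_isHalfDeriv : IsClosed {p : L2t X × L2t X | IsHalfDeriv p.1 p.2} := by
  let a : ℝ → ℝ := fun ξ => |2 * Real.pi * ξ| ^ (1 / 2 : ℝ)
  have ha : ∀ ξ, 0 ≤ a ξ := fun ξ => by positivity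
  have hac : Continuous a := by
    refine Continuous.rpow_const (by fun_prop) fun ξ => Or.inr (by norm_num)
  have hm1 : MemLp (fun ξ => ((1 / (1 + a ξ) : ℝ) : ℂ)) ∞ (volume : Measure ℝ) := by
    refine memLp_top_of_bound (C := 1) ?_ (Filter.Eventually.of_forall fun ξ => ?_)
    · refine Measurable.aestronglyMeasurable ?_
      have := hac.measurable
      fun_prop
    · have := ha ξ
      rw [Complex.norm_real, Real.norm_of_nonneg (by positivity)]
      exact div_le_one_of_le₀ (by linarith) (by linarith)
  have hm2 : MemLp (fun ξ => ((a ξ / (1 + a ξ) : ℝ) : ℂ)) ∞ (volume : Measure ℝ) := by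
    refine memLp_top_of_bound (C := 1) ?_ (Filter.Eventually.of_forall fun ξ => ?_)
    · refine Measurable.aestronglyMeasurable ?_
      have := hac.measurable
      fun_prop
    · have := ha ξ
      rw [Complex.norm_real, Real.norm_of_nonneg (by positivity)]
      exact div_le_one_of_le₀ (by linarith) (by linarith)
  have key : {p : L2t X × L2t X | IsHalfDeriv p.1 p.2} =
      {p | mulLp _ hm1 (𝓕 p.2) = mulLp _ hm2 (𝓕 p.1)} := by
    ext ⟨u, g⟩
    have hpt : ∀ ξ, (𝓕 g ξ = ((a ξ : ℝ) : ℂ) • 𝓕 u ξ) ↔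
        ((1 / (1 + a ξ) : ℝ) : ℂ) • 𝓕 g ξ = ((a ξ / (1 + a ξ) : ℝ) : ℂ) • 𝓕 u ξ := by
      intro ξ
      have h0 : ((1 / (1 + a ξ) : ℝ) : ℂ) ≠ 0 := by
        have := ha ξ
        exact_mod_cast (by positivity : (1 / (1 + a ξ) : ℝ) ≠ 0)
      have e : ((a ξ / (1 + a ξ) : ℝ) : ℂ) = ((1 / (1 + a ξ) : ℝ) : ℂ) * ((a ξ : ℝ) : ℂ) := by
        rw [← Complex.ofReal_mul]; congr 1; ring
      rw [e, mul_smul]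
      exact ⟨fun h => by rw [h], fun h => smul_right_injective _ h0 h⟩
    constructor
    · intro h
      refine Lp.ext ?_
      filter_upwards [h, coeFn_mulLp hm1 (𝓕 g), coeFn_mulLp hm2 (𝓕 u)] with ξ h1 h2 h3
      rw [h2, h3]
      exact (hpt ξ).1 h1
    · intro h
      have h' : mulLp _ hm1 (𝓕 g) = mulLp _ hm2 (𝓕 u) := h
      have h2 := coeFn_mulLp hm1 (𝓕 g)
      rw [h'] at h2
      change ∀ᵐ ξ : ℝ, _
      filter_upwards [h2, coeFn_mulLp hm2 (𝓕 u)] with ξ h2 h3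
      exact (hpt ξ).2 (h2.symm.trans h3)
  rw [key]
  exact isClosed_eq
    ((mulLp _ hm1).continuous.comp ((Lp.fourierTransformₗᵢ ℝ X).continuous.comp continuous_snd))
    ((mulLp _ hm2).continuous.comp ((Lp.fourierTransformₗᵢ ℝ X).continuous.comp continuous_fst))

/-- The elements of `L²(ℝ; X)` whose Fourier transform is `ξ ↦ g(ξ) c` with a test function `g` and
`c ∈ X` serve as test functions in time: they have half derivatives after every change of space. -/
lemma exists_fourier_eq_smul (g : ℝ → ℝ) (hg : ContDiff ℝ ∞ g) (hgs : HasCompactSupport g) (c : X) :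
    ∃ w : L2t X, (∀ᵐ ξ : ℝ, 𝓕 w ξ = g ξ • c) ∧
      ∀ T : X →L[ℂ] Y, ∃ k : L2t Y, IsHalfDeriv (T.compLpL 2 volume w) k := by
  have hm : MemLp (fun ξ => g ξ • c) 2 (volume : Measure ℝ) :=
    (hg.continuous.smul continuous_const).memLp_of_hasCompactSupport hgs.smul_right
  have hF : 𝓕 ((Lp.fourierTransformₗᵢ ℝ X).symm hm.toLp) = hm.toLp :=
    (Lp.fourierTransformₗᵢ ℝ X).apply_symm_apply _
  have hw : ∀ᵐ ξ : ℝ, 𝓕 ((Lp.fourierTransformₗᵢ ℝ X).symm hm.toLp) ξ = g ξ • c := by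
    rw [hF]
    exact hm.coeFn_toLp
  refine ⟨(Lp.fourierTransformₗᵢ ℝ X).symm hm.toLp, hw, fun T => ?_⟩
  have hac : Continuous (fun ξ : ℝ => |2 * Real.pi * ξ| ^ (1 / 2 : ℝ)) :=
    Continuous.rpow_const (by fun_prop) fun ξ => Or.inr (by norm_num)
  have hm' : MemLp (fun ξ => g ξ • ((|2 * Real.pi * ξ| ^ (1 / 2 : ℝ) : ℝ) : ℂ) • T c) 2
      (volume : Measure ℝ) :=
    (hg.continuous.smul ((Complex.continuous_ofReal.comp hac).smul
      continuous_const)).memLp_of_hasCompactSupport hgs.smul_right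
  refine ⟨(Lp.fourierTransformₗᵢ ℝ Y).symm hm'.toLp, ?_⟩
  have hF' : 𝓕 ((Lp.fourierTransformₗᵢ ℝ Y).symm hm'.toLp) = hm'.toLp :=
    (Lp.fourierTransformₗᵢ ℝ Y).apply_symm_apply _
  change ∀ᵐ ξ : ℝ, _
  rw [hF', fourier_compLpL]
  filter_upwards [hw, T.coeFn_compLpL (𝓕 ((Lp.fourierTransformₗᵢ ℝ X).symm hm.toLp)),
    hm'.coeFn_toLp] with ξ h1 h2 h3
  rw [h2, h1, h3, ← smul_comm]
  congr 1
  exact (T.restrictScalars ℝ).map_smul (g ξ) c |>.symm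

/-- A locally integrable function vanishes if it is orthogonal to the functions `g c` with test
functions `g` and vectors `c`. -/
lemma ae_eq_zero_of_forall_integral_inner_smul {F : ℝ → X} (hF : LocallyIntegrable F)
    (h : ∀ g : ℝ → ℝ, ContDiff ℝ ∞ g → HasCompactSupport g → ∀ c : X,
      ∫ ξ, inner ℂ (g ξ • c) (F ξ) = 0) : ∀ᵐ ξ, F ξ = 0 := by
  refine ae_eq_zero_of_integral_contDiff_smul_eq_zero hF fun g hg hgs => ?_
  refine ext_inner_left ℂ fun c => ?_
  rw [inner_zero_right, ← h g hg hgs c, ← integral_inner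
    (hF.integrable_smul_left_of_hasCompactSupport hg.continuous hgs)]
  refine integral_congr_ae (Filter.Eventually.of_forall fun ξ => ?_)
  simp only
  rw [RCLike.real_smul_eq_coe_smul (K := ℂ), RCLike.real_smul_eq_coe_smul (K := ℂ),
    inner_smul_left, inner_smul_right, RCLike.conj_ofReal]

end Fourier

/-! ### The symbol of the time derivative and half derivatives -/

section HalfDerivative

variable {X Y : Type*} [NormedAddCommGroup X] [InnerProductSpace ℂ X] [CompleteSpace X]
  [NormedAddCommGroup Y] [InnerProductSpace ℂ Y] [CompleteSpace Y]

/-- On the Fourier side the form `-(D_t^{1/2} u | H_t D_t^{1/2} w)` has the symbol `iτ`. -/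
lemma neg_inner_hilbertT_halfDeriv {u h w k : L2t Y} (hu : IsHalfDeriv u h) (hw : IsHalfDeriv w k) :
    -inner ℂ (hilbertT k) h =
      ∫ ξ : ℝ, inner ℂ (𝓕 w ξ) ((2 * Real.pi * Complex.I * ξ : ℂ) • 𝓕 u ξ) := by
  rw [inner_fourier, ← integral_neg]
  refine integral_congr_ae ?_
  filter_upwards [hu, hw, fourier_hilbertT k] with ξ h1 h2 h3
  rw [h3, h2, h1, smul_smul, inner_smul_left, inner_smul_right, inner_smul_right]
  have hs : Real.sign ξ * (|2 * Real.pi * ξ| ^ (1 / 2 : ℝ) * |2 * Real.pi * ξ| ^ (1 / 2 : ℝ)) =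
      2 * Real.pi * ξ := by
    rw [← Real.sqrt_eq_rpow, Real.mul_self_sqrt (abs_nonneg _), abs_mul,
      abs_of_pos (by positivity : (0 : ℝ) < 2 * Real.pi), mul_left_comm]
    rcases lt_trichotomy ξ 0 with h | rfl | h
    · rw [Real.sign_of_neg h, abs_of_neg h]; ring
    · simp
    · rw [Real.sign_of_pos h, abs_of_pos h]; ring
  have hs' := congrArg (fun r : ℝ => (r : ℂ)) hs
  push_cast at hs'
  simp only [map_mul, Complex.conj_I, Complex.conj_ofReal]
  linear_combination (Complex.I * inner ℂ (𝓕 w ξ) (𝓕 u ξ)) * hs'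

/-- The half derivative of `T v` exists, since `|τ| ‖T v̂‖² = |(v̂ | q̂)| ≤ ‖q̂‖ ‖v̂‖` is integrable. -/
lemma memLp_halfDeriv_fourier (T : X →L[ℂ] Y) {v q : L2t X}
    (h : ∀ᵐ ξ : ℝ, 𝓕 q ξ = (2 * Real.pi * Complex.I * ξ : ℂ) • (T.adjoint.comp T) (𝓕 v ξ)) :
    MemLp (fun ξ : ℝ => ((|2 * Real.pi * ξ| ^ (1 / 2 : ℝ) : ℝ) : ℂ) • T (𝓕 v ξ)) 2 := by
  have hac : Continuous (fun ξ : ℝ => |2 * Real.pi * ξ| ^ (1 / 2 : ℝ)) :=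
    Continuous.rpow_const (by fun_prop) fun ξ => Or.inr (by norm_num)
  have hmeas : AEStronglyMeasurable
      (fun ξ : ℝ => ((|2 * Real.pi * ξ| ^ (1 / 2 : ℝ) : ℝ) : ℂ) • T (𝓕 v ξ)) volume :=
    (Complex.continuous_ofReal.comp hac).aestronglyMeasurable.smul
      (T.continuous.comp_aestronglyMeasurable (Lp.aestronglyMeasurable _))
  rw [memLp_two_iff_integrable_sq_norm hmeas]
  refine (integrable_norm_mul_norm (𝓕 q) (𝓕 v)).mono' (hmeas.norm.pow 2) ?_
  filter_upwards [h] with ξ hξ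
  rw [Real.norm_of_nonneg (by positivity), norm_smul, mul_pow, Complex.norm_real,
    Real.norm_of_nonneg (by positivity), ← Real.sqrt_eq_rpow, Real.sq_sqrt (abs_nonneg _)]
  have e : inner ℂ (𝓕 v ξ) (𝓕 q ξ) =
      (2 * Real.pi * Complex.I * ξ : ℂ) * ((‖T (𝓕 v ξ)‖ ^ 2 : ℝ) : ℂ) := by
    rw [hξ, inner_smul_right, ContinuousLinearMap.comp_apply,
      ContinuousLinearMap.adjoint_inner_right, inner_self_eq_norm_sq_to_K]
    norm_cast
  have h2 := norm_inner_le_norm (𝕜 := ℂ) (𝓕 v ξ) (𝓕 q ξ)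
  rw [e, norm_mul, Complex.norm_real, Real.norm_of_nonneg (by positivity)] at h2
  have e2 : ‖(2 * Real.pi * Complex.I * ξ : ℂ)‖ = |2 * Real.pi * ξ| := by
    simp [abs_mul, abs_of_pos Real.pi_pos]
  rw [e2] at h2
  linarith

/-- The bridge between the two notions of a time derivative: for `v ∈ L²(ℝ; X)` and `T : X → Y`,
the function `q` is the derivative of `T* T v` if and only if `T v` has a half derivative and `q`
represents the form `-(D_t^{1/2} T v | H_t D_t^{1/2} T w)`. The converse direction
tests with functions whose Fourier transforms are smooth and compactly supported. -/
lemma fourier_eq_iff_exists_halfDeriv (T : X →L[ℂ] Y) (v q : L2t X) :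
    (∀ᵐ ξ : ℝ, 𝓕 q ξ = (2 * Real.pi * Complex.I * ξ : ℂ) • (T.adjoint.comp T) (𝓕 v ξ)) ↔
    ∃ h : L2t Y, IsHalfDeriv (T.compLpL 2 volume v) h ∧
      ∀ (w : L2t X) (k : L2t Y), IsHalfDeriv (T.compLpL 2 volume w) k →
        -inner ℂ (hilbertT k) h = inner ℂ w q := by
  have pairing : ∀ {h : L2t Y} {w : L2t X} {k : L2t Y}, IsHalfDeriv (T.compLpL 2 volume v) h →
      IsHalfDeriv (T.compLpL 2 volume w) k → -inner ℂ (hilbertT k) h =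
        ∫ ξ : ℝ, inner ℂ (𝓕 w ξ)
          ((2 * Real.pi * Complex.I * ξ : ℂ) • (T.adjoint.comp T) (𝓕 v ξ)) := by
    intro h w k hh hk
    rw [neg_inner_hilbertT_halfDeriv hh hk, fourier_compLpL, fourier_compLpL]
    refine integral_congr_ae ?_
    filter_upwards [T.coeFn_compLpL (𝓕 v), T.coeFn_compLpL (𝓕 w)] with ξ h1 h2
    rw [h1, h2, inner_smul_right, inner_smul_right, ContinuousLinearMap.comp_apply,
      ContinuousLinearMap.adjoint_inner_right]
  constructor
  · intro hq
    have hm := memLp_halfDeriv_fourier T hq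
    have hF : 𝓕 ((Lp.fourierTransformₗᵢ ℝ Y).symm hm.toLp) = hm.toLp :=
      (Lp.fourierTransformₗᵢ ℝ Y).apply_symm_apply _
    have hh : IsHalfDeriv (T.compLpL 2 volume v) ((Lp.fourierTransformₗᵢ ℝ Y).symm hm.toLp) := by
      change ∀ᵐ ξ : ℝ, _
      rw [hF, fourier_compLpL]
      filter_upwards [T.coeFn_compLpL (𝓕 v), hm.coeFn_toLp] with ξ h1 h2
      rw [h1, h2]
    refine ⟨_, hh, fun w k hk => ?_⟩
    rw [pairing hh hk, inner_fourier]
    refine integral_congr_ae ?_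
    filter_upwards [hq] with ξ h1
    rw [h1]
  · rintro ⟨h, hh, hq⟩
    have hloc : LocallyIntegrable (fun ξ : ℝ => (2 * Real.pi * Complex.I * ξ : ℂ) •
        (T.adjoint.comp T) (𝓕 v ξ)) := by
      have h1 : LocallyIntegrable (((T.adjoint.comp T).compLpL 2 volume (𝓕 v) : L2t X) : ℝ → X) :=
        (Lp.memLp _).locallyIntegrable (by norm_num)
      have h2 : LocallyIntegrable (fun ξ : ℝ => (2 * Real.pi * Complex.I * ξ : ℂ) •
          ((T.adjoint.comp T).compLpL 2 volume (𝓕 v) : L2t X) ξ) :=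
        locallyIntegrableOn_univ.1 ((locallyIntegrableOn_univ.2 h1).continuousOn_smul
          isOpen_univ.isLocallyClosed (by fun_prop))
      refine h2.congr ?_
      filter_upwards [(T.adjoint.comp T).coeFn_compLpL (𝓕 v)] with ξ h3
      rw [h3]
    have hlocq : LocallyIntegrable ((𝓕 q : L2t X) : ℝ → X) :=
      (Lp.memLp _).locallyIntegrable (by norm_num)
    have hz := ae_eq_zero_of_forall_integral_inner_smul (hlocq.sub hloc) fun g hg hgs c => ?_
    · filter_upwards [hz] with ξ h1
      exact sub_eq_zero.1 h1
    · obtain ⟨w, hw, hwk⟩ := exists_fourier_eq_smul (Y := Y) g hg hgs c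
      obtain ⟨k, hk⟩ := hwk T
      have h1 := hq w k hk
      rw [pairing hh hk, inner_fourier, eq_comm] at h1
      have i1 : ∫ ξ, inner ℂ (g ξ • c) (𝓕 q ξ) = ∫ ξ, inner ℂ (𝓕 w ξ) (𝓕 q ξ) :=
        integral_congr_ae (by filter_upwards [hw] with ξ h2; rw [h2])
      have i2 : ∫ ξ : ℝ, inner ℂ (g ξ • c)
            ((2 * Real.pi * Complex.I * ξ : ℂ) • (T.adjoint.comp T) (𝓕 v ξ)) =
          ∫ ξ : ℝ, inner ℂ (𝓕 w ξ)
            ((2 * Real.pi * Complex.I * ξ : ℂ) • (T.adjoint.comp T) (𝓕 v ξ)) :=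
        integral_congr_ae (by filter_upwards [hw] with ξ h2; rw [h2])
      have int : ∀ {F : ℝ → X}, LocallyIntegrable F →
          Integrable (fun ξ => inner ℂ (g ξ • c) (F ξ)) := by
        intro F hF
        have h3 := (hF.integrable_smul_left_of_hasCompactSupport hg.continuous hgs).const_inner
          (𝕜 := ℂ) c
        refine h3.congr (Filter.Eventually.of_forall fun ξ => ?_)
        simp only
        rw [RCLike.real_smul_eq_coe_smul (K := ℂ), RCLike.real_smul_eq_coe_smul (K := ℂ),
          inner_smul_left, inner_smul_right, RCLike.conj_ofReal]
      simp only [Pi.sub_apply, inner_sub_right]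
      rw [integral_sub (int hlocq) (int hloc), i1, i2, h1, sub_self]

/-- If `T` has dense range, then the functions in `L²(ℝ; Y)` of the form `T w` whose half derivative
exists separate the points of `L²(ℝ; Y)`. -/
lemma eq_zero_of_forall_inner_halfDeriv (T : X →L[ℂ] Y) (hT : DenseRange T) (f : L2t Y)
    (hf : ∀ (w : L2t X) (k : L2t Y), IsHalfDeriv (T.compLpL 2 volume w) k →
      inner ℂ (T.compLpL 2 volume w) f = 0) : f = 0 := by
  have hloc : LocallyIntegrable ((T.adjoint.compLpL 2 volume (𝓕 f) : L2t X) : ℝ → X) :=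
    (Lp.memLp _).locallyIntegrable (by norm_num)
  have hz := ae_eq_zero_of_forall_integral_inner_smul hloc fun g hg hgs c => ?_
  · apply L2t.fourier_injective
    have e : 𝓕 (0 : L2t Y) = 0 := (Lp.fourierTransformₗᵢ ℝ Y).map_zero
    rw [e]
    refine Lp.ext ?_
    filter_upwards [hz, T.adjoint.coeFn_compLpL (𝓕 f), Lp.coeFn_zero Y 2 (volume : Measure ℝ)]
      with ξ h1 h2 h3
    rw [h3, Pi.zero_apply]
    rw [h2] at h1
    refine hT.eq_zero_of_inner_left ℂ fun y => ?_
    rw [← ContinuousLinearMap.adjoint_inner_left, h1, inner_zero_left]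
  · obtain ⟨w, hw, hwk⟩ := exists_fourier_eq_smul (Y := Y) g hg hgs c
    obtain ⟨k, hk⟩ := hwk T
    rw [← hf w k hk, inner_fourier, fourier_compLpL]
    refine integral_congr_ae ?_
    filter_upwards [hw, T.adjoint.coeFn_compLpL (𝓕 f), T.coeFn_compLpL (𝓕 w)] with ξ h1 h2 h3
    rw [h2, h3, h1, ContinuousLinearMap.adjoint_inner_right]

end HalfDerivative

/-! ### Weak derivatives in time -/

section WeakDerivative

variable {X : Type*} [NormedAddCommGroup X] [NormedSpace ℂ X]

lemma integrable_schwartz_smul (φ : SchwartzMap ℝ ℂ) (z : L2t X) :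
    Integrable (fun t => φ t • z t) :=
  memLp_one_iff_integrable.1 ((Lp.memLp z).smul (φ.memLp 2 volume))

lemma HasWeakDeriv.compLpL {Y : Type*} [NormedAddCommGroup Y] [NormedSpace ℂ Y] [CompleteSpace X]
    [CompleteSpace Y] (T : X →L[ℂ] Y) {z g : L2t X} (h : HasWeakDeriv z g) :
    HasWeakDeriv (T.compLpL 2 volume z) (T.compLpL 2 volume g) := by
  intro φ hφ hφs
  have key : ∀ (ψ : ℝ → ℂ), Continuous ψ → HasCompactSupport ψ → ∀ u : L2t X,
      ∫ t, ψ t • (T.compLpL 2 volume u) t = T (∫ t, ψ t • u t) := by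
    intro ψ hψ hψs u
    have hi : Integrable (fun t => ψ t • u t) := memLp_one_iff_integrable.1
      ((Lp.memLp u).smul (hψ.memLp_of_hasCompactSupport (p := 2) hψs))
    rw [← T.integral_comp_comm hi]
    refine integral_congr_ae ?_
    filter_upwards [T.coeFn_compLpL u] with t ht
    rw [ht, map_smul]
  rw [key _ (hφ.continuous_deriv (by simp)) hφs.deriv, key _ hφ.continuous hφs, h φ hφ hφs, map_neg]

/-- A weak derivative may be tested with Schwartz functions: cut them off at `|t| ∼ k` and let
`k → ∞`. -/
lemma HasWeakDeriv.integral_schwartz {z g : L2t X} (h : HasWeakDeriv z g)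
    (φ : SchwartzMap ℝ ℂ) : ∫ t, deriv φ t • z t = -∫ t, φ t • g t := by
  -- The cut-offs are `χ k t = b (t / (k + 1))` for a bump function `b`, so `χ k' = O(1 / k)`.
  let b : ContDiffBump (0 : ℝ) := ⟨1, 2, one_pos, one_lt_two⟩
  let r : ℕ → ℝ := fun k => 1 / ((k : ℝ) + 1)
  have hr : ∀ k, 0 < r k ∧ r k ≤ 1 := fun k =>
    ⟨by positivity, div_le_one_of_le₀ (by linarith [k.cast_nonneg (α := ℝ)]) (by positivity)⟩
  have hr0 : Filter.Tendsto r Filter.atTop (nhds 0) := tendsto_one_div_add_atTop_nhds_zero_nat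
  obtain ⟨C, hC⟩ : ∃ C, ∀ s, ‖deriv b s‖ ≤ C :=
    (b.contDiff.continuous_deriv (n := 1) le_rfl).bounded_above_of_compact_support
      b.hasCompactSupport.deriv
  have hC0 : 0 ≤ C := (norm_nonneg _).trans (hC 0)
  let χ : ℕ → ℝ → ℂ := fun k t => ((b (r k * t) : ℝ) : ℂ)
  have hb : ContDiff ℝ ∞ b := b.contDiff
  have hχd : ∀ k t, HasDerivAt (χ k) ((deriv b (r k * t) * r k : ℝ) : ℂ) t := by
    intro k t
    have h1 : HasDerivAt (fun t : ℝ => r k * t) (r k) t := by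
      simpa using (hasDerivAt_id t).const_mul (r k)
    have h2 : HasDerivAt b (deriv b (r k * t)) (r k * t) :=
      (hb.differentiable (by simp) _).hasDerivAt
    exact (h2.comp t h1).ofReal_comp
  have hprod : ∀ k t, deriv (fun t => χ k t * φ t) t =
      ((deriv b (r k * t) * r k : ℝ) : ℂ) * φ t + χ k t * deriv φ t := fun k t =>
    ((hχd k t).mul (φ.hasDerivAt t)).deriv
  have hχ1 : ∀ k t, ‖χ k t‖ ≤ 1 := by
    intro k t
    rw [Complex.norm_real, Real.norm_of_nonneg b.nonneg]
    exact b.le_one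
  have hχs : ∀ k, HasCompactSupport (χ k) := by
    intro k
    have h1 : HasCompactSupport (fun t : ℝ => b (r k * t)) :=
      b.hasCompactSupport.comp_homeomorph (Homeomorph.mulLeft₀ (r k) (hr k).1.ne')
    exact h1.comp_left (g := fun x : ℝ => (x : ℂ)) Complex.ofReal_zero
  have hχc : ∀ k, ContDiff ℝ ∞ (χ k) := fun k =>
    Complex.ofRealCLM.contDiff.comp (hb.comp (contDiff_const.mul contDiff_id))
  have hlim : ∀ t, Filter.Tendsto (fun k => χ k t) Filter.atTop (nhds 1) := by
    intro t
    have h1 : Filter.Tendsto (fun k => r k * t) Filter.atTop (nhds 0) := by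
      simpa using hr0.mul_const t
    have h2 := (b.continuous.tendsto 0).comp h1
    rw [b.one_of_mem_closedBall (by simp [b])] at h2
    have h3 := (Complex.continuous_ofReal.tendsto 1).comp h2
    rw [Complex.ofReal_one] at h3
    exact h3
  have hlim' : ∀ t, Filter.Tendsto (fun k => deriv (fun t => χ k t * φ t) t) Filter.atTop
      (nhds (deriv φ t)) := by
    intro t
    simp only [hprod]
    have h1 : Filter.Tendsto (fun k => ((deriv b (r k * t) * r k : ℝ) : ℂ)) Filter.atTop
        (nhds 0) := by
      refine squeeze_zero_norm (a := fun k => C * r k) (fun k => ?_) (by simpa using hr0.const_mul C)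
      rw [Complex.norm_real, norm_mul, Real.norm_of_nonneg (hr k).1.le]
      exact mul_le_mul_of_nonneg_right (hC _) (hr k).1.le
    simpa using (h1.mul_const (φ t)).add ((hlim t).mul_const (deriv φ t))
  have hint' : Integrable (fun t => ‖φ t‖ * ‖z t‖) :=
    (integrable_schwartz_smul φ z).norm.congr (Filter.Eventually.of_forall fun t => norm_smul _ _)
  have hintd : Integrable (fun t => ‖deriv φ t‖ * ‖z t‖) :=
    (integrable_schwartz_smul (SchwartzMap.derivCLM ℂ ℂ φ) z).norm.congr
      (Filter.Eventually.of_forall fun t => norm_smul _ _)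
  have hintg : Integrable (fun t => ‖φ t‖ * ‖g t‖) :=
    (integrable_schwartz_smul φ g).norm.congr (Filter.Eventually.of_forall fun t => norm_smul _ _)
  have hcd : ∀ k, ContDiff ℝ ∞ (fun t => χ k t * φ t) := fun k => (hχc k).mul φ.smooth'
  have L1 : Filter.Tendsto (fun k => ∫ t, deriv (fun t => χ k t * φ t) t • z t) Filter.atTop
      (nhds (∫ t, deriv φ t • z t)) := by
    refine tendsto_integral_of_dominated_convergence
      (fun t => C * (‖φ t‖ * ‖z t‖) + ‖deriv φ t‖ * ‖z t‖) (fun k => ?_)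
      ((hint'.const_mul C).add hintd) (fun k => Filter.Eventually.of_forall fun t => ?_)
      (Filter.Eventually.of_forall fun t => (hlim' t).smul_const _)
    · exact ((hcd k).continuous_deriv (by simp)).aestronglyMeasurable.smul
        (Lp.aestronglyMeasurable z)
    · rw [norm_smul, hprod, ← mul_assoc, ← add_mul]
      refine mul_le_mul_of_nonneg_right ((norm_add_le _ _).trans (add_le_add ?_ ?_))
        (norm_nonneg _)
      · rw [norm_mul, Complex.norm_real, norm_mul, Real.norm_of_nonneg (hr k).1.le]
        refine mul_le_mul_of_nonneg_right ?_ (norm_nonneg _)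
        calc _ ≤ C * 1 := mul_le_mul (hC _) (hr k).2 (hr k).1.le hC0
          _ = C := mul_one C
      · rw [norm_mul]
        exact mul_le_of_le_one_left (norm_nonneg _) (hχ1 k t)
  have L2 : Filter.Tendsto (fun k => ∫ t, (χ k t * φ t) • g t) Filter.atTop
      (nhds (∫ t, φ t • g t)) := by
    refine tendsto_integral_of_dominated_convergence (fun t => ‖φ t‖ * ‖g t‖) (fun k => ?_)
      hintg (fun k => Filter.Eventually.of_forall fun t => ?_)
      (Filter.Eventually.of_forall fun t => ?_)
    · exact (hcd k).continuous.aestronglyMeasurable.smul (Lp.aestronglyMeasurable g)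
    · rw [norm_smul, norm_mul]
      exact mul_le_mul_of_nonneg_right (mul_le_of_le_one_left (norm_nonneg _) (hχ1 k t))
        (norm_nonneg _)
    · simpa using ((hlim t).mul_const (φ t)).smul_const (g t)
  refine tendsto_nhds_unique L1 ?_
  simp only [h _ (hcd _) ((hχs _).mul_right)]
  exact L2.neg

end WeakDerivative

section WeakDerivativeFourier

variable {X : Type*} [NormedAddCommGroup X] [InnerProductSpace ℂ X] [CompleteSpace X]

/-- Weak derivatives in time correspond to multiplication by `iτ` on the Fourier side. -/
lemma hasWeakDeriv_iff_fourier (z g : L2t X) :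
    HasWeakDeriv z g ↔ ∀ᵐ ξ : ℝ, 𝓕 g ξ = (2 * Real.pi * Complex.I * ξ : ℂ) • 𝓕 z ξ := by
  -- The derivative of `ψ̂` is the Fourier transform of `-2πiξ ψ`; transpose the Fourier transform.
  have hderiv : ∀ (ψ : SchwartzMap ℝ ℂ) (u : L2t X), ∫ t, deriv (𝓕 ψ : SchwartzMap ℝ ℂ) t • u t =
      -∫ ξ : ℝ, ψ ξ • (2 * Real.pi * Complex.I * ξ : ℂ) • 𝓕 u ξ := by
    intro ψ u
    have htg : Function.HasTemperateGrowth (fun ξ : ℝ => (-(2 * Real.pi * Complex.I * ξ) : ℂ)) := by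
      fun_prop
    have e : deriv (𝓕 ψ : SchwartzMap ℝ ℂ) = (𝓕 (SchwartzMap.smulLeftCLM ℂ
        (fun ξ : ℝ => (-(2 * Real.pi * Complex.I * ξ) : ℂ)) ψ) : SchwartzMap ℝ ℂ) := by
      rw [SchwartzMap.fourier_coe, SchwartzMap.fourier_coe, Real.deriv_fourier ψ.integrable]
      · congr 1
        ext ξ
        rw [SchwartzMap.smulLeftCLM_apply_apply htg]
        simp only [smul_eq_mul]
        ring
      · have htg' : Function.HasTemperateGrowth (fun ξ : ℝ => (ξ : ℂ)) := by fun_prop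
        refine (SchwartzMap.smulLeftCLM ℂ (fun ξ : ℝ => (ξ : ℂ)) ψ).integrable.congr
          (Filter.Eventually.of_forall fun ξ => ?_)
        rw [SchwartzMap.smulLeftCLM_apply_apply htg', smul_eq_mul]
        exact (Complex.real_smul).symm
    rw [e, integral_fourier_smul, ← integral_neg]
    refine integral_congr_ae (Filter.Eventually.of_forall fun ξ => ?_)
    simp only
    rw [SchwartzMap.smulLeftCLM_apply_apply htg, smul_smul, smul_eq_mul, ← neg_smul]
    congr 1
    ring
  constructor
  · intro h
    have hloc : LocallyIntegrable (fun ξ : ℝ => (2 * Real.pi * Complex.I * ξ : ℂ) • 𝓕 z ξ) := by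
      have h1 : LocallyIntegrable ((𝓕 z : L2t X) : ℝ → X) :=
        (Lp.memLp _).locallyIntegrable (by norm_num)
      exact locallyIntegrableOn_univ.1 ((locallyIntegrableOn_univ.2 h1).continuousOn_smul
          isOpen_univ.isLocallyClosed (by fun_prop))
    refine ae_eq_of_integral_contDiff_smul_eq ((Lp.memLp _).locallyIntegrable (by norm_num)) hloc
      fun ρ hρ hρs => ?_
    have hs : HasCompactSupport (fun ξ => (ρ ξ : ℂ)) :=
      hρs.comp_left (g := fun x : ℝ => (x : ℂ)) Complex.ofReal_zero
    let ψ : SchwartzMap ℝ ℂ := hs.toSchwartzMap (Complex.ofRealCLM.contDiff.comp hρ)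
    have h1 := h.integral_schwartz (𝓕 ψ)
    rw [hderiv, integral_fourier_smul] at h1
    exact (neg_injective h1).symm
  · intro h φ hφ hφs
    let Φ : SchwartzMap ℝ ℂ := hφs.toSchwartzMap hφ
    have e : (𝓕 (𝓕⁻ Φ) : SchwartzMap ℝ ℂ) = Φ := FourierTransform.fourier_fourierInv_eq Φ
    have h1 := hderiv (𝓕⁻ Φ) z
    have h2 := integral_fourier_smul (𝓕⁻ Φ) g
    rw [e] at h1 h2
    change ∫ t, deriv Φ t • z t = -∫ t, Φ t • g t
    rw [h1, h2]
    congr 1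
    refine integral_congr_ae ?_
    filter_upwards [h] with ξ h3
    rw [h3]

end WeakDerivativeFourier

/-! ### Lax–Milgram with hidden coercivity and maximal accretive operators -/

section Riesz

variable {X : Type*} [NormedAddCommGroup X] [InnerProductSpace ℂ X] [CompleteSpace X]

/-- The Riesz isomorphism `X ≃ X*` onto the anti-dual space, `v ↦ (w ↦ (v | w))`. -/
def rieszAnti : X ≃ₗᵢ[ℂ] AntiDual X :=
  LinearIsometryEquiv.ofSurjective
    { toFun := fun v => innerSLFlip ℂ v
      map_add' := fun v w => map_add _ v w
      map_smul' := fun c v => map_smul _ c v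
      norm_map' := fun v => by
        refine le_antisymm (ContinuousLinearMap.opNorm_le_bound _ (norm_nonneg _) fun w => ?_) ?_
        · exact (norm_inner_le_norm w v).trans_eq (mul_comm _ _)
        · rcases eq_or_ne v 0 with rfl | hv
          · simp
          have h1 : ‖inner ℂ v v‖ ≤ ‖innerSLFlip ℂ v‖ * ‖v‖ := (innerSLFlip ℂ v).le_opNorm v
          rw [inner_self_eq_norm_sq_to_K, norm_pow, RCLike.norm_ofReal, abs_norm, sq] at h1
          exact le_of_mul_le_mul_right h1 (norm_pos_iff.2 hv) }
    (by
      intro f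
      let g : StrongDual ℂ X := LinearMap.mkContinuous
        { toFun := fun w => conj (f w)
          map_add' := fun a b => by simp
          map_smul' := fun c a => by simp } ‖f‖ fun w => by simpa using f.le_opNorm w
      refine ⟨(InnerProductSpace.toDual ℂ X).symm g, ?_⟩
      ext w
      change inner ℂ w ((InnerProductSpace.toDual ℂ X).symm g) = f w
      rw [← inner_conj_symm, InnerProductSpace.toDual_symm_apply]
      exact Complex.conj_conj _)

lemma rieszAnti_apply (v w : X) : rieszAnti v w = inner ℂ w v := rfl

lemma inner_rieszAnti_symm (f : AntiDual X) (w : X) : inner ℂ w (rieszAnti.symm f) = f w := by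
  rw [← rieszAnti_apply, LinearIsometryEquiv.apply_symm_apply]

/-- A form of the Lax–Milgram lemma with hidden coercivity: it suffices that `u ↦ B u (R u)` is
coercive for some surjective `R`. -/
lemma existsUnique_and_norm_le_of_coercive (B : X →L[ℂ] AntiDual X) (R : X → X)
    (hR : Function.Surjective R) {δ M : ℝ} (hδ : 0 < δ) (hM : ∀ u, ‖R u‖ ≤ M * ‖u‖)
    (hB : ∀ u, δ * ‖u‖ ^ 2 ≤ (B u (R u)).re) :
    (∀ f, ∃! u, B u = f) ∧ ∀ u, ‖u‖ ≤ M / δ * ‖B u‖ := by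
  have hbound : ∀ u, ‖u‖ ≤ M / δ * ‖B u‖ := by
    intro u
    rcases eq_or_ne u 0 with rfl | hu
    · simp
    have hu' : 0 < ‖u‖ := norm_pos_iff.2 hu
    have h1 : δ * ‖u‖ ^ 2 ≤ ‖B u‖ * (M * ‖u‖) :=
      (hB u).trans ((Complex.re_le_norm _).trans (((B u).le_opNorm _).trans
        (mul_le_mul_of_nonneg_left (hM u) (norm_nonneg _))))
    rw [div_mul_eq_mul_div, le_div_iff₀ hδ]
    have h2 : (‖u‖ * δ) * ‖u‖ ≤ (M * ‖B u‖) * ‖u‖ := by nlinarith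
    exact le_of_mul_le_mul_right h2 hu'
  refine ⟨?_, hbound⟩
  let B' : X →L[ℂ] X :=
    (rieszAnti (X := X)).symm.toContinuousLinearEquiv.toContinuousLinearMap.comp B
  have hB' : ∀ u w, inner ℂ w (B' u) = B u w := fun u w => inner_rieszAnti_symm (B u) w
  have hnorm : ∀ u, ‖B' u‖ = ‖B u‖ := fun u => (rieszAnti (X := X)).symm.norm_map (B u)
  have hanti : AntilipschitzWith (M / δ).toNNReal B' :=
    ContinuousLinearMap.antilipschitz_of_bound B' fun u => by
      rw [hnorm]
      exact (hbound u).trans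
        (mul_le_mul_of_nonneg_right (Real.le_coe_toNNReal _) (norm_nonneg _))
  have hcl : IsClosed (B'.range : Set X) := hanti.isClosed_range B'.uniformContinuous
  have htop : B'.range = ⊤ := by
    -- A vector `R u` orthogonal to the range satisfies `B u (R u) = 0`, hence `u = 0`.
    have := hcl.completeSpace_coe
    rw [← B'.range.orthogonal_orthogonal, Submodule.eq_top_iff']
    intro v w hw
    obtain ⟨u, rfl⟩ := hR w
    have h0 : B u (R u) = 0 := by
      have h : inner ℂ (B' u) (R u) = 0 := (Submodule.mem_orthogonal _ _).1 hw _ ⟨u, rfl⟩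
      rw [← hB', ← inner_conj_symm, h, map_zero]
    have h1 := hB u
    rw [h0, Complex.zero_re] at h1
    have h2 : u = 0 := by
      by_contra h
      have h' := norm_pos_iff.2 h
      have : 0 < δ * ‖u‖ ^ 2 := by positivity
      linarith
    have h3 : R u = 0 := by
      rw [← norm_le_zero_iff]
      simpa [h2] using hM u
    rw [h3, inner_zero_left]
  intro f
  obtain ⟨u, hu⟩ : rieszAnti.symm f ∈ B'.range := htop ▸ Submodule.mem_top
  have hu' : B u = f := (rieszAnti (X := X)).symm.injective hu
  exact ⟨u, hu', fun v hv => hanti.injective (by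
    change rieszAnti.symm (B v) = rieszAnti.symm (B u)
    rw [hv, hu'])⟩

/-- An accretive operator with the resolvent estimates is densely defined and has no proper
accretive extension, since `1 + T` is surjective and `1 + S` is injective for accretive `S`. -/
lemma isMaximalAccretive_of_resolvent (T : X →ₗ.[ℂ] X) (hT : IsAccretive T)
    (hres : ∀ z : ℂ, 0 < z.re → ∀ f : X, ∃ u : T.domain, z • (u : X) + T u = f) :
    IsMaximalAccretive T := by
  -- The resolvent bound holds for every accretive operator `S`; test `z u + S u` with `u`.
  have hbd : ∀ (S : X →ₗ.[ℂ] X), IsAccretive S → ∀ z : ℂ, 0 < z.re → ∀ u : S.domain,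
      ‖(u : X)‖ ≤ ‖z • (u : X) + S u‖ / z.re := by
    intro S hS z hz u
    rcases eq_or_ne (u : X) 0 with hu | hu
    · rw [hu, norm_zero]
      positivity
    have hu' : 0 < ‖(u : X)‖ := norm_pos_iff.2 hu
    have h1 : z.re * ‖(u : X)‖ ^ 2 ≤ (inner ℂ (u : X) (z • (u : X) + S u)).re := by
      rw [inner_add_right, inner_smul_right, inner_self_eq_norm_sq_to_K, Complex.add_re]
      have h2 := hS u
      have h3 : (z * ((‖(u : X)‖ : ℝ) : ℂ) ^ 2).re = z.re * ‖(u : X)‖ ^ 2 := by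
        rw [← Complex.ofReal_pow, Complex.re_mul_ofReal]
      change _ ≤ (z * ((‖(u : X)‖ : ℝ) : ℂ) ^ 2).re + _
      rw [h3]
      linarith
    have h2 := h1.trans ((Complex.re_le_norm _).trans (norm_inner_le_norm _ _))
    rw [le_div_iff₀ hz]
    refine le_of_mul_le_mul_left (a := ‖(u : X)‖) ?_ hu'
    linarith
  have hinj : ∀ (S : X →ₗ.[ℂ] X), IsAccretive S → ∀ z : ℂ, 0 < z.re → ∀ u v : S.domain,
      z • (u : X) + S u = z • (v : X) + S v → u = v := by
    intro S hS z hz u v h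
    have h1 := hbd S hS z hz (u - v)
    have h2 : z • ((u - v : S.domain) : X) + S (u - v) = 0 := by
      rw [LinearPMap.map_sub, Submodule.coe_sub, smul_sub, ← sub_eq_zero.2 h]
      abel
    rw [h2, norm_zero, zero_div, norm_le_zero_iff, Submodule.coe_sub, sub_eq_zero] at h1
    exact Subtype.ext h1
  refine ⟨?_, hT, fun z hz f => ?_, hbd T hT, fun S hS hTS => ?_⟩
  -- If `f` is orthogonal to the domain and `u + T u = f`, then `‖u‖² + (T u | u) = (f | u) = 0`.
  · rw [Submodule.dense_iff_topologicalClosure_eq_top, Submodule.topologicalClosure_eq_top_iff,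
      Submodule.eq_bot_iff]
    intro f hf
    obtain ⟨u, hu⟩ := hres 1 (by simp) f
    have h0 : inner ℂ (u : X) f = 0 := (Submodule.mem_orthogonal _ _).1 hf _ u.2
    rw [← hu, one_smul, inner_add_right, inner_self_eq_norm_sq_to_K] at h0
    have h1 := congrArg Complex.re h0
    have h3 : ((((‖(u : X)‖ : ℝ) : ℂ)) ^ 2).re = ‖(u : X)‖ ^ 2 := by
      rw [← Complex.ofReal_pow, Complex.ofReal_re]
    have h4 : ((((‖(u : X)‖ : ℝ) : ℂ)) ^ 2).re + (inner ℂ (u : X) (T u)).re = 0 := h1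
    rw [h3] at h4
    have h5 : u = 0 := by
      have := hT u
      have h6 : ‖(u : X)‖ = 0 := by nlinarith [norm_nonneg (u : X), sq_nonneg ‖(u : X)‖]
      exact Subtype.ext (norm_eq_zero.1 h6)
    rw [← hu, h5]
    simp
  · obtain ⟨u, hu⟩ := hres z hz f
    exact ⟨u, hu, fun v hv => hinj T hT z hz v u (hv.trans hu.symm)⟩
  · refine (LinearPMap.eq_of_le_of_domain_eq hTS (le_antisymm hTS.1 fun x hx => ?_)).symm
    obtain ⟨u, hu⟩ := hres 1 (by simp) ((1 : ℂ) • x + S ⟨x, hx⟩)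
    have h1 : S ⟨(u : X), hTS.1 u.2⟩ = T u := (hTS.2 rfl).symm
    have h2 := hinj S hS 1 (by simp) ⟨(u : X), hTS.1 u.2⟩ ⟨x, hx⟩ (by rw [h1]; exact hu)
    have h3 : (u : X) = x := congrArg Subtype.val h2
    exact h3 ▸ u.2

end Riesz

/-! ### The form domain and the elliptic form -/

lemma norm_sq_eq_integral {α X : Type*} [MeasurableSpace α] {μ : Measure α}
    [NormedAddCommGroup X] [InnerProductSpace ℂ X] (f : Lp X 2 μ) :
    ‖f‖ ^ 2 = ∫ t, ‖f t‖ ^ 2 ∂μ := by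
  have h1 := inner_self_eq_norm_sq_to_K (𝕜 := ℂ) f
  rw [L2.inner_def] at h1
  have h2 : ∫ t, inner ℂ (f t) (f t) ∂μ = ((∫ t, ‖f t‖ ^ 2 ∂μ : ℝ) : ℂ) := by
    rw [← integral_complex_ofReal]
    refine integral_congr_ae (Filter.Eventually.of_forall fun t => ?_)
    simp only
    rw [inner_self_eq_norm_sq_to_K]
    norm_cast
  rw [h2, ← RCLike.ofReal_pow] at h1
  exact (Complex.ofReal_injective h1).symm

section Space

variable {n : ℕ} {Ω : Set (EuclideanSpace ℝ (Fin n))} {V : Submodule ℂ (L2pair Ω)}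

lemma IsFormDomain.completeSpace (hV : IsFormDomain Ω V) : CompleteSpace (FormSpace V) :=
  hV.isClosed.completeSpace_coe

instance : SecondCountableTopology (FormSpace V) :=
  have : Fact ((2 : ℝ≥0∞) ≠ ⊤) := ⟨ENNReal.ofNat_ne_top⟩
  have : SecondCountableTopology (L2pair Ω) := WithLp.secondCountableTopology 2 (L2 Ω) (L2vec Ω)
  TopologicalSpace.Subtype.secondCountableTopology (V : Set (L2pair Ω))

lemma norm_sq_formSpace (v : FormSpace V) : ‖v‖ ^ 2 = ‖emb V v‖ ^ 2 + ‖grad V v‖ ^ 2 :=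
  WithLp.prod_norm_sq_eq_of_L2 (incl V v)

/-- Weak gradients are unique on an open set, so a function in `V` is determined by its class in
`L²(Ω)`. -/
lemma emb_injective (hΩ : IsOpen Ω) (hV : IsFormDomain Ω V) : Function.Injective (emb V) := by
  refine (injective_iff_map_eq_zero (emb V)).2 fun v hv => ?_
  have hw := hV.le_sobolev _ (show V from v).2
  have h0 : (incl V v).fst = 0 := hv
  have h0' := Lp.coeFn_zero ℂ 2 (volume.restrict Ω)
  have hz : ∀ i : Fin n, ∀ᵐ x ∂(volume.restrict Ω), (incl V v).snd x i = 0 := by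
    intro i
    have hloc : LocallyIntegrableOn (fun x => (incl V v).snd x i) Ω volume := by
      have h1 : MemLp (fun x => (incl V v).snd x i) 2 (volume.restrict Ω) :=
        (EuclideanSpace.proj (𝕜 := ℂ) i).comp_memLp' (Lp.memLp (incl V v).snd)
      exact locallyIntegrableOn_of_locallyIntegrable_restrict (h1.locallyIntegrable (by norm_num))
    rw [ae_restrict_iff' hΩ.measurableSet]
    refine hΩ.ae_eq_zero_of_integral_contDiff_smul_eq_zero hloc fun g hg hgs hgt => ?_
    have hs : HasCompactSupport (fun x => (g x : ℂ)) :=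
      hgs.comp_left (g := fun x : ℝ => (x : ℂ)) Complex.ofReal_zero
    have ht : tsupport (fun x => (g x : ℂ)) ⊆ Ω :=
      (tsupport_comp_subset (g := fun x : ℝ => (x : ℂ)) Complex.ofReal_zero g).trans hgt
    have h2 := hw _ (Complex.ofRealCLM.contDiff.comp hg) hs ht i
    have h3 : ∫ x in Ω, (incl V v).fst x * fderiv ℝ (fun x => (g x : ℂ)) x
        (EuclideanSpace.single i 1) = 0 := by
      rw [h0]
      refine integral_eq_zero_of_ae ?_
      filter_upwards [h0'] with x hx
      rw [hx]
      simp
    have h4 : ∫ x in Ω, (incl V v).snd x i * (g x : ℂ) = 0 :=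
      neg_eq_zero.1 (h2.symm.trans h3)
    rw [← setIntegral_eq_integral_of_forall_compl_eq_zero (s := Ω), ← h4]
    · refine integral_congr_ae (Filter.Eventually.of_forall fun x => ?_)
      simp only
      rw [Complex.real_smul, mul_comm]
    · intro x hx
      rw [image_eq_zero_of_notMem_tsupport fun h => hx (hgt h), zero_smul]
  have hg : (incl V v).snd = 0 := by
    refine Lp.ext ?_
    filter_upwards [ae_all_iff.2 hz, Lp.coeFn_zero (EuclideanSpace ℂ (Fin n)) 2
      (volume.restrict Ω)] with x hx hx'
    rw [hx']
    ext i
    exact hx i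
  rw [← norm_eq_zero, ← sq_eq_zero_iff, norm_sq_formSpace, hv]
  have : grad V v = 0 := hg
  rw [this]
  simp

/-- `V` contains the test functions, so it is dense in `L²(Ω)`. -/
lemma denseRange_emb (hΩ : IsOpen Ω) (hV : IsFormDomain Ω V) : DenseRange (emb V) := by
  have : Dense ((emb V).range : Set (L2 Ω)) := by
    rw [Submodule.dense_iff_topologicalClosure_eq_top, Submodule.topologicalClosure_eq_top_iff,
      Submodule.eq_bot_iff]
    intro f hf
    have hloc : LocallyIntegrableOn f Ω volume :=
      locallyIntegrableOn_of_locallyIntegrable_restrict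
        ((Lp.memLp f).locallyIntegrable (by norm_num))
    have hz := hΩ.ae_eq_zero_of_integral_contDiff_smul_eq_zero hloc fun g hg hgs hgt => ?_
    · rw [← ae_restrict_iff' hΩ.measurableSet] at hz
      refine Lp.ext ?_
      filter_upwards [hz, Lp.coeFn_zero ℂ 2 (volume.restrict Ω)] with x h1 h2
      rw [h1, h2, Pi.zero_apply]
    · let φ : EuclideanSpace ℝ (Fin n) → ℂ := fun x => (g x : ℂ)
      have hφ : ContDiff ℝ ∞ φ := Complex.ofRealCLM.contDiff.comp hg
      have hs : HasCompactSupport φ :=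
        hgs.comp_left (g := fun x : ℝ => (x : ℂ)) Complex.ofReal_zero
      have ht : tsupport φ ⊆ Ω :=
        (tsupport_comp_subset (g := fun x : ℝ => (x : ℂ)) Complex.ofReal_zero g).trans hgt
      have h1 : MemLp φ 2 (volume.restrict Ω) := hφ.continuous.memLp_of_hasCompactSupport hs
      let G : EuclideanSpace ℝ (Fin n) → EuclideanSpace ℂ (Fin n) := fun x =>
        WithLp.toLp 2 fun i => fderiv ℝ φ x (EuclideanSpace.single i 1)
      have hGc : Continuous G := by
        refine (PiLp.continuous_toLp 2 _).comp (continuous_pi fun i => ?_)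
        exact (hφ.continuous_fderiv (by simp)).clm_apply continuous_const
      have hGs : HasCompactSupport G :=
        (hs.fderiv ℝ).comp_left (g := fun L : EuclideanSpace ℝ (Fin n) →L[ℝ] ℂ =>
          (WithLp.toLp 2 fun i => L (EuclideanSpace.single i 1) : EuclideanSpace ℂ (Fin n)))
          (by ext i; simp)
      have h2 : MemLp G 2 (volume.restrict Ω) := hGc.memLp_of_hasCompactSupport hGs
      let Φ : L2 Ω := h1.toLp φ
      let Γ : L2vec Ω := h2.toLp G
      let p : L2pair Ω := WithLp.toLp 2 (Φ, Γ)
      have hp : p ∈ V := by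
        refine hV.sobolevZero_le (subset_closure ⟨φ, hφ, hs, ht, h1.coeFn_toLp, fun i => ?_⟩)
        filter_upwards [h2.coeFn_toLp] with x hx
        change Γ x i = _
        rw [show Γ x = G x from hx]
      have h3 : inner ℂ (emb V (⟨p, hp⟩ : V)) f = 0 :=
        (Submodule.mem_orthogonal _ _).1 hf _ ⟨_, rfl⟩
      have h4 : emb V (⟨p, hp⟩ : V) = h1.toLp := rfl
      rw [h4, L2.inner_def] at h3
      rw [← setIntegral_eq_integral_of_forall_compl_eq_zero (s := Ω), ← h3]
      · refine integral_congr_ae ?_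
        filter_upwards [h1.coeFn_toLp] with x hx
        rw [hx]
        simp [φ, mul_comm]
      · intro x hx
        rw [image_eq_zero_of_notMem_tsupport fun h => hx (hgt h), zero_smul]
  exact this

variable {A : ℝ → EuclideanSpace ℝ (Fin n) → Matrix (Fin n) (Fin n) ℂ} {lam Lam : ℝ}

/-- The gradients of functions with values in `V`, as elements of `L²(ℝ; L²(Ω)ⁿ)`. -/
abbrev gradT (V : Submodule ℂ (L2pair Ω)) : L2t (FormSpace V) →L[ℂ] L2t (L2vec Ω) :=
  (grad V).compLpL 2 volume

lemma IsElliptic.ae_aemeasurable (hA : IsElliptic Ω A lam Lam) :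
    ∀ᵐ t : ℝ, ∀ i j, AEMeasurable (fun x => A t x i j) (volume.restrict Ω) := by
  rw [ae_all_iff]
  intro i
  rw [ae_all_iff]
  intro j
  filter_upwards [(hA.measurable i j).aestronglyMeasurable.prodMk_left] with t ht
  exact ht.aemeasurable

lemma IsElliptic.form_coercive (hA : IsElliptic Ω A lam Lam) :
    ∀ᵐ t : ℝ, ∀ v : FormSpace V, lam * ‖grad V v‖ ^ 2 ≤ (form V (A t) v v).re := by
  filter_upwards [hA.ae_aemeasurable] with t ht v
  have hint := (form_integrand V ht (hA.bounded t) v v).2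
  have h1 : (form V (A t) v v).re =
      ∫ x in Ω, ((A t x).mulVec (grad V v x) ⬝ᵥ star (grad V v x : Fin n → ℂ)).re :=
    (integral_re hint).symm
  have h2 : ‖grad V v‖ ^ 2 = ∫ x in Ω, ‖grad V v x‖ ^ 2 :=
    norm_sq_eq_integral _
  rw [h1, h2, ← integral_const_mul]
  refine integral_mono_ae ((memLp_two_iff_integrable_sq_norm
    (Lp.aestronglyMeasurable _)).1 (Lp.memLp (grad V v)) |>.const_mul lam) hint.re ?_
  filter_upwards [hA.coercive t] with x hx
  exact hx _

lemma IsElliptic.norm_form_le (hA : IsElliptic Ω A lam Lam) (hL : 0 ≤ Lam) :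
    ∀ᵐ t : ℝ, ∀ v w : FormSpace V, ‖form V (A t) v w‖ ≤ Lam * (‖grad V v‖ * ‖grad V w‖) := by
  filter_upwards [hA.ae_aemeasurable] with t ht v w
  refine (norm_integral_le_of_norm_le
    ((integrable_norm_mul_norm (grad V v) (grad V w)).const_mul Lam)
    (form_integrand V ht (hA.bounded t) v w).1).trans ?_
  rw [integral_const_mul]
  exact mul_le_mul_of_nonneg_left (integral_norm_mul_norm_le _ _) hL

/-- The two bounds on the coefficients are compared at one point of `Ω` and one unit vector. -/
lemma IsElliptic.le (hA : IsElliptic Ω A lam Lam) (hn : 0 < n) (hΩ : IsOpen Ω)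
    (hΩ' : Ω.Nonempty) : lam ≤ Lam := by
  have : (ae (volume.restrict Ω)).NeBot := by
    rw [ae_neBot, Ne, Measure.restrict_eq_zero]
    exact (hΩ.measure_pos volume hΩ').ne'
  obtain ⟨x, h1, h2⟩ := ((hA.coercive 0).and (hA.bounded 0)).exists
  have e1 : ‖EuclideanSpace.single (⟨0, hn⟩ : Fin n) (1 : ℂ)‖ = 1 := by simp
  have e2 : ‖WithLp.toLp 2 (star (EuclideanSpace.single (⟨0, hn⟩ : Fin n) (1 : ℂ) :
      Fin n → ℂ))‖ = 1 := by
    rw [← e1]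
    simp only [EuclideanSpace.norm_eq, Pi.star_apply, norm_star]
  have h3 := h1 (EuclideanSpace.single (⟨0, hn⟩ : Fin n) 1)
  have h4 := h2 (EuclideanSpace.single (⟨0, hn⟩ : Fin n) 1)
    (WithLp.toLp 2 (star (EuclideanSpace.single (⟨0, hn⟩ : Fin n) (1 : ℂ) : Fin n → ℂ)))
  rw [e1, e2] at h4
  rw [e1] at h3
  have h5 := h3.trans ((Complex.re_le_norm _).trans h4)
  linarith

/-- Coercivity of the form, integrated in time. -/
lemma IsElliptic.integral_form_coercive (hA : IsElliptic Ω A lam Lam) (hL : 0 ≤ Lam)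
    (u : L2t (FormSpace V)) :
    lam * ‖gradT V u‖ ^ 2 ≤ (∫ t, form V (A t) (u t) (u t)).re := by
  have hint := (form_time_integrable V hA hL u u).1
  have h1 : (∫ t, form V (A t) (u t) (u t)).re = ∫ t, (form V (A t) (u t) (u t)).re :=
    (integral_re hint).symm
  rw [h1, norm_sq_eq_integral, ← integral_const_mul]
  refine integral_mono_ae ((memLp_two_iff_integrable_sq_norm
    (Lp.aestronglyMeasurable _)).1 (Lp.memLp (gradT V u)) |>.const_mul lam) hint.re ?_
  filter_upwards [hA.form_coercive (V := V), (grad V).coeFn_compLpL u] with t h2 h3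
  rw [h3]
  exact h2 _

lemma IsElliptic.norm_integral_form_le (hA : IsElliptic Ω A lam Lam) (hL : 0 ≤ Lam)
    (u w : L2t (FormSpace V)) :
    ‖∫ t, form V (A t) (u t) (w t)‖ ≤ Lam * (‖gradT V u‖ * ‖gradT V w‖) := by
  refine (norm_integral_le_of_norm_le
    ((integrable_norm_mul_norm (gradT V u) (gradT V w)).const_mul Lam) ?_).trans ?_
  · filter_upwards [hA.norm_form_le (V := V) hL, (grad V).coeFn_compLpL u,
      (grad V).coeFn_compLpL w] with t h1 h2 h3
    rw [h2, h3]
    exact h1 _ _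
  · rw [integral_const_mul]
    exact mul_le_mul_of_nonneg_left (integral_norm_mul_norm_le _ _) hL

lemma norm_sq_L2t_formSpace (u : L2t (FormSpace V)) :
    ‖u‖ ^ 2 = ‖(emb V).compLpL 2 volume u‖ ^ 2 + ‖gradT V u‖ ^ 2 := by
  have hi : ∀ {X : Type} [NormedAddCommGroup X] [InnerProductSpace ℂ X] (f : L2t X),
      Integrable (fun t => ‖f t‖ ^ 2) := fun f =>
    (memLp_two_iff_integrable_sq_norm (Lp.aestronglyMeasurable f)).1 (Lp.memLp f)
  rw [norm_sq_eq_integral, norm_sq_eq_integral, norm_sq_eq_integral,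
    ← integral_add (hi _) (hi _)]
  refine integral_congr_ae ?_
  filter_upwards [(emb V).coeFn_compLpL u, (grad V).coeFn_compLpL u] with t h1 h2
  rw [h1, h2, norm_sq_formSpace]

end Space

/-! ### The energy space and its Hilbert transform -/

section Energy

variable {n : ℕ} {Ω : Set (EuclideanSpace ℝ (Fin n))} {V : Submodule ℂ (L2pair Ω)}

/-- The element of the energy space given by `v ∈ L²(ℝ; V)` with half derivative `h`. -/
def EnergySpace.mk (v : L2t (FormSpace V)) (h : L2t (L2 Ω))
    (hv : IsHalfDeriv ((emb V).compLpL 2 volume v) h) : EnergySpace V :=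
  (⟨WithLp.toLp 2 (v, h), hv⟩ : energySubmodule V)

@[simp] lemma toL2V_mk (v : L2t (FormSpace V)) (h : L2t (L2 Ω))
    (hv : IsHalfDeriv ((emb V).compLpL 2 volume v) h) : toL2V V (.mk v h hv) = v := rfl

@[simp] lemma halfDeriv_mk (v : L2t (FormSpace V)) (h : L2t (L2 Ω))
    (hv : IsHalfDeriv ((emb V).compLpL 2 volume v) h) : halfDeriv V (.mk v h hv) = h := rfl

lemma isHalfDeriv_halfDeriv (u : EnergySpace V) : IsHalfDeriv (toL2H V u) (halfDeriv V u) :=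
  (show energySubmodule V from u).2

@[ext] lemma EnergySpace.ext {u w : EnergySpace V} (h1 : toL2V V u = toL2V V w)
    (h2 : halfDeriv V u = halfDeriv V w) : u = w := by
  refine Subtype.ext ?_
  exact (WithLp.ofLp_injective 2) (Prod.ext h1 h2)

lemma norm_sq_energySpace (u : EnergySpace V) :
    ‖u‖ ^ 2 = ‖toL2V V u‖ ^ 2 + ‖halfDeriv V u‖ ^ 2 :=
  WithLp.prod_norm_sq_eq_of_L2 (energyIncl V u)

variable (V) in
lemma isClosed_energySubmodule :
    IsClosed (energySubmodule V : Set (WithLp 2 (L2t (FormSpace V) × L2t (L2 Ω)))) :=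
  isClosed_setOf_isHalfDeriv.preimage (f := fun p : WithLp 2 (L2t (FormSpace V) × L2t (L2 Ω)) =>
    ((emb V).compLpL 2 volume p.fst, p.snd))
    ((((emb V).compLpL 2 volume).continuous.comp (WithLp.continuous_fst 2 _ _)).prodMk
      (WithLp.continuous_snd 2 _ _))

instance [CompleteSpace (FormSpace V)] : CompleteSpace (EnergySpace V) :=
  (isClosed_energySubmodule V).completeSpace_coe

lemma toL2H_apply (u : EnergySpace V) : toL2H V u = (emb V).compLpL 2 volume (toL2V V u) := rfl

/-- An element of the energy space is determined by its class in `L²(ℝ; H)`, because weak gradients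
in space and half derivatives in time are unique. -/
lemma toL2H_injective (hΩ : IsOpen Ω) (hV : IsFormDomain Ω V) :
    Function.Injective (toL2H V) := by
  refine (injective_iff_map_eq_zero (toL2H V)).2 fun u hu => ?_
  have h1 : toL2V V u = 0 := by
    refine Lp.ext ?_
    have h2 := (emb V).coeFn_compLpL (toL2V V u)
    rw [← toL2H_apply, hu] at h2
    filter_upwards [h2, Lp.coeFn_zero (L2 Ω) 2 (volume : Measure ℝ),
      Lp.coeFn_zero (FormSpace V) 2 (volume : Measure ℝ)] with t h3 h4 h5
    rw [h5, Pi.zero_apply]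
    refine emb_injective hΩ hV ?_
    rw [← h3, h4, map_zero, Pi.zero_apply]
  refine EnergySpace.ext (by rw [h1, map_zero]) ?_
  rw [map_zero]
  apply L2t.fourier_injective
  refine Lp.ext ?_
  have h2 := isHalfDeriv_halfDeriv u
  have e : (𝓕 (0 : L2t (L2 Ω))) = 0 := (Lp.fourierTransformₗᵢ ℝ (L2 Ω)).map_zero
  have h3 : ∀ᵐ ξ : ℝ, 𝓕 (halfDeriv V u) ξ =
    (((|2 * Real.pi * ξ|) ^ (1 / 2 : ℝ) : ℝ) : ℂ) • 𝓕 (toL2H V u) ξ := h2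
  rw [hu, e] at h3
  rw [e]
  filter_upwards [h3, Lp.coeFn_zero (L2 Ω) 2 (volume : Measure ℝ)] with ξ h4 h5
  rw [h4, h5, Pi.zero_apply, smul_zero]

variable [CompleteSpace (FormSpace V)]

/-- The Hilbert transform on the energy space. -/
def energyHilbert : EnergySpace V →ₗ[ℂ] EnergySpace V where
  toFun u := .mk (hilbertT (toL2V V u)) (hilbertT (halfDeriv V u)) (by
    rw [← hilbertT_compLpL]
    exact (isHalfDeriv_halfDeriv u).hilbertT_comm)
  map_add' u w := EnergySpace.ext (by simp) (by simp)
  map_smul' c u := EnergySpace.ext (by simp) (by simp)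

@[simp] lemma toL2V_energyHilbert (u : EnergySpace V) :
    toL2V V (energyHilbert u) = hilbertT (toL2V V u) := rfl

@[simp] lemma halfDeriv_energyHilbert (u : EnergySpace V) :
    halfDeriv V (energyHilbert u) = hilbertT (halfDeriv V u) := rfl

lemma toL2H_energyHilbert (u : EnergySpace V) :
    toL2H V (energyHilbert u) = hilbertT (toL2H V u) := by
  rw [toL2H_apply, toL2H_apply, toL2V_energyHilbert, hilbertT_compLpL]

lemma energyHilbert_energyHilbert (u : EnergySpace V) : energyHilbert (energyHilbert u) = -u :=
  EnergySpace.ext (by simp [hilbertT_hilbertT]) (by simp [hilbertT_hilbertT])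

lemma norm_sq_add_smul_hilbertT {X : Type*} [NormedAddCommGroup X] [InnerProductSpace ℂ X]
    [CompleteSpace X] (δ : ℝ) (u : L2t X) :
    ‖u + (δ : ℂ) • hilbertT u‖ ^ 2 = (1 + δ ^ 2) * ‖u‖ ^ 2 := by
  rw [norm_add_sq (𝕜 := ℂ), norm_smul, norm_hilbertT, inner_smul_right, Complex.norm_real,
    Real.norm_eq_abs, mul_pow, sq_abs]
  have h : RCLike.re ((δ : ℂ) * inner ℂ u (hilbertT u)) = 0 := by
    have h1 : (inner ℂ u (hilbertT u)).re = (inner ℂ (hilbertT u) u).re :=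
      inner_re_symm (𝕜 := ℂ) _ _
    change ((δ : ℂ) * inner ℂ u (hilbertT u)).re = 0
    rw [Complex.re_ofReal_mul, h1, re_inner_hilbertT_self, mul_zero]
  rw [h]
  ring

lemma norm_add_smul_energyHilbert (δ : ℝ) (u : EnergySpace V) :
    ‖u + (δ : ℂ) • energyHilbert u‖ ^ 2 = (1 + δ ^ 2) * ‖u‖ ^ 2 := by
  rw [norm_sq_energySpace, norm_sq_energySpace, map_add, map_smul, map_add, map_smul,
    toL2V_energyHilbert, halfDeriv_energyHilbert, norm_sq_add_smul_hilbertT,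
    norm_sq_add_smul_hilbertT]
  ring

lemma surjective_add_smul_energyHilbert (δ : ℝ) :
    Function.Surjective fun u : EnergySpace V => u + (δ : ℂ) • energyHilbert u := by
  intro w
  -- The inverse is `(1 - δ H_t) / (1 + δ²)`, since `H_t² = -1`.
  have h : (1 + (δ : ℂ) ^ 2) ≠ 0 := by
    exact_mod_cast (by positivity : (1 + δ ^ 2 : ℝ) ≠ 0)
  refine ⟨(1 + (δ : ℂ) ^ 2)⁻¹ • (w - (δ : ℂ) • energyHilbert w), ?_⟩
  simp only
  rw [map_smul, map_sub, map_smul, energyHilbert_energyHilbert, smul_comm (δ : ℂ), ← smul_add,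
    inv_smul_eq_iff₀ h, add_smul, one_smul, smul_sub, smul_neg, smul_neg, smul_smul, sq]
  abel

end Energy

/-! ### Hidden coercivity of the parabolic operator -/

section Operator

variable {n : ℕ} {Ω : Set (EuclideanSpace ℝ (Fin n))} {V : Submodule ℂ (L2pair Ω)}
  {A : ℝ → EuclideanSpace ℝ (Fin n) → Matrix (Fin n) (Fin n) ℂ} {lam Lam : ℝ}

lemma parabolicOp_apply (hA : IsElliptic Ω A lam Lam) (hL : 0 ≤ Lam) (u w : EnergySpace V) :
    parabolicOp V hA hL u w = -inner ℂ (hilbertT (halfDeriv V w)) (halfDeriv V u) +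
      ∫ t, form V (A t) (toL2V V u t) (toL2V V w t) := by
  rw [L2.inner_def, ← integral_neg]
  exact integral_add
    (L2.integrable_inner (𝕜 := ℂ) (hilbertT (halfDeriv V w)) (halfDeriv V u)).neg
    (form_time_integrable V hA hL (toL2V V u) (toL2V V w)).1

lemma dualEmb_embDualT_apply (f : L2t (L2 Ω)) (w : EnergySpace V) :
    dualEmb V (embDualT V f) w = inner ℂ (toL2H V w) f := by
  rw [L2.inner_def, toL2H_apply]
  refine integral_congr_ae ?_
  filter_upwards [(embDual V).coeFn_compLpL f, (emb V).coeFn_compLpL (toL2V V w)] with t h1 h2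
  rw [h2]
  exact congrArg (fun F : AntiDual (FormSpace V) => F (toL2V V w t)) h1

lemma shiftedOp_apply (hA : IsElliptic Ω A lam Lam) (hL : 0 ≤ Lam) (θ : ℂ)
    (u w : EnergySpace V) :
    shiftedOp V hA hL θ u w = θ * inner ℂ (toL2H V w) (toL2H V u) +
      (-inner ℂ (hilbertT (halfDeriv V w)) (halfDeriv V u) +
      ∫ t, form V (A t) (toL2V V u t) (toL2V V w t)) := by
  rw [← parabolicOp_apply hA hL, ← dualEmb_embDualT_apply]
  rfl

lemma inner_self_eq_ofReal {X : Type*} [NormedAddCommGroup X] [InnerProductSpace ℂ X] (u : X) :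
    inner ℂ u u = ((‖u‖ ^ 2 : ℝ) : ℂ) := by
  rw [inner_self_eq_norm_sq_to_K, ← RCLike.ofReal_pow]
  rfl

/-- Testing with `u`: the time part is purely imaginary. -/
lemma re_shiftedOp_self (hA : IsElliptic Ω A lam Lam) (hL : 0 ≤ Lam) (θ : ℂ)
    (u : EnergySpace V) :
    θ.re * ‖toL2H V u‖ ^ 2 + lam * ‖gradT V (toL2V V u)‖ ^ 2 ≤
      (shiftedOp V hA hL θ u u).re := by
  rw [shiftedOp_apply, inner_self_eq_ofReal, Complex.add_re, Complex.re_mul_ofReal, Complex.add_re,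
    Complex.neg_re, re_inner_hilbertT_self, neg_zero, zero_add]
  exact add_le_add_right (hA.integral_form_coercive hL _) _

variable [CompleteSpace (FormSpace V)]

/-- Testing with `H_t u` brings in `‖D_t^{1/2} u‖²`, since `-(D_t^{1/2} u | H_t² D_t^{1/2} u)` equals
`‖D_t^{1/2} u‖²`. -/
lemma re_shiftedOp_energyHilbert (hA : IsElliptic Ω A lam Lam) (hL : 0 ≤ Lam) (θ : ℂ)
    (u : EnergySpace V) :
    ‖halfDeriv V u‖ ^ 2 - |θ.im| * ‖toL2H V u‖ ^ 2 - Lam * ‖gradT V (toL2V V u)‖ ^ 2 ≤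
      (shiftedOp V hA hL θ u (energyHilbert u)).re := by
  rw [shiftedOp_apply, halfDeriv_energyHilbert, hilbertT_hilbertT, inner_neg_left, neg_neg,
    inner_self_eq_ofReal, toL2V_energyHilbert, toL2H_energyHilbert, Complex.add_re, Complex.add_re,
    Complex.ofReal_re, Complex.mul_re, re_inner_hilbertT_self, mul_zero, zero_sub]
  have h1 : θ.im * (inner ℂ (hilbertT (toL2H V u)) (toL2H V u)).im ≤
      |θ.im| * ‖toL2H V u‖ ^ 2 := by
    refine (le_abs_self _).trans ?_
    rw [abs_mul]
    refine mul_le_mul_of_nonneg_left ?_ (abs_nonneg _)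
    refine (Complex.abs_im_le_norm _).trans ((norm_inner_le_norm _ _).trans_eq ?_)
    rw [norm_hilbertT, sq]
  have h2 := hA.norm_integral_form_le hL (toL2V V u) (hilbertT (toL2V V u))
  rw [gradT, ← hilbertT_compLpL, norm_hilbertT, ← sq] at h2
  have h3 := (abs_le.1 ((Complex.abs_re_le_norm _).trans h2)).1
  linarith

/-- The hidden coercivity of `θ + 𝔏`: it shows when testing with `u + δ H_t u` for small `δ`. -/
lemma shiftedOp_hidden_coercivity (hA : IsElliptic Ω A lam Lam) (hL : 0 ≤ Lam) (θ : ℂ) {δ : ℝ}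
    (hδ : 0 ≤ δ) (h1 : δ * (Lam + 1) ≤ lam) (h2 : δ * (|θ.im| + 1) ≤ θ.re) (u : EnergySpace V) :
    δ * ‖u‖ ^ 2 ≤ (shiftedOp V hA hL θ u (u + (δ : ℂ) • energyHilbert u)).re := by
  have e : shiftedOp V hA hL θ u (u + (δ : ℂ) • energyHilbert u) =
      shiftedOp V hA hL θ u u + (δ : ℂ) * shiftedOp V hA hL θ u (energyHilbert u) := by
    rw [map_add, map_smulₛₗ, Complex.conj_ofReal, smul_eq_mul]
  rw [e, Complex.add_re, Complex.re_ofReal_mul, norm_sq_energySpace, norm_sq_L2t_formSpace,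
    ← toL2H_apply]
  have h3 := re_shiftedOp_self hA hL θ u
  have h4 := mul_le_mul_of_nonneg_left (re_shiftedOp_energyHilbert hA hL θ u) hδ
  have h5 := mul_le_mul_of_nonneg_right h1 (sq_nonneg ‖gradT V (toL2V V u)‖)
  have h6 := mul_le_mul_of_nonneg_right h2 (sq_nonneg ‖toL2H V u‖)
  linarith

/-- Unique solvability in the energy space; the coercivity constant is `δ = 1 / K`, where `K` is the
maximum in the bound. -/
lemma shiftedOp_bijective_and_norm_le (hA : IsElliptic Ω A lam Lam) (hlam : 0 < lam)
    (hL : 0 ≤ Lam) (hle : lam ≤ Lam) (θ : ℂ) (hθ : 0 < θ.re) :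
    (∀ f, ∃! u, shiftedOp V hA hL θ u = f) ∧
    ∀ u, ‖u‖ ≤ √2 * max ((Lam + 1) / lam) ((|θ.im| + 1) / θ.re) * ‖shiftedOp V hA hL θ u‖ := by
  set K := max ((Lam + 1) / lam) ((|θ.im| + 1) / θ.re) with hK
  have hK1 : 1 ≤ K := by
    refine le_trans ?_ (le_max_left _ _)
    rw [one_le_div hlam]
    linarith
  have hK0 : 0 < K := one_pos.trans_le hK1
  have hδ1 : 1 / K * (Lam + 1) ≤ lam := by
    rw [one_div_mul_eq_div, div_le_iff₀ hK0, ← div_le_iff₀' hlam]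
    exact le_max_left _ _
  have hδ2 : 1 / K * (|θ.im| + 1) ≤ θ.re := by
    rw [one_div_mul_eq_div, div_le_iff₀ hK0, ← div_le_iff₀' hθ]
    exact le_max_right _ _
  have hM : ∀ u : EnergySpace V, ‖u + ((1 / K : ℝ) : ℂ) • energyHilbert u‖ ≤ √2 * ‖u‖ := by
    intro u
    refine (sq_le_sq₀ (norm_nonneg _) (by positivity)).1 ?_
    rw [norm_add_smul_energyHilbert, mul_pow, Real.sq_sqrt (by norm_num)]
    have h1 : (1 / K) ^ 2 ≤ 1 := by
      refine pow_le_one₀ (by positivity) ?_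
      rw [div_le_one hK0]
      exact hK1
    nlinarith [sq_nonneg ‖u‖]
  have h := existsUnique_and_norm_le_of_coercive (shiftedOp V hA hL θ) _
    (surjective_add_smul_energyHilbert (1 / K)) (by positivity) hM
    (shiftedOp_hidden_coercivity hA hL θ (by positivity) hδ1 hδ2)
  refine ⟨h.1, fun u => (h.2 u).trans_eq ?_⟩
  rw [div_div_eq_mul_div, div_one]

end Operator

/-! ### Equivalence with the pointwise equation and the part in `L²(ℝ; H)` -/

section Equation

variable {n : ℕ} {Ω : Set (EuclideanSpace ℝ (Fin n))} {V : Submodule ℂ (L2pair Ω)}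
  {A : ℝ → EuclideanSpace ℝ (Fin n) → Matrix (Fin n) (Fin n) ℂ} {lam Lam : ℝ}

/-- The graph of the part of `𝔏` in `L²(ℝ; H)`. -/
def partGraph (V : Submodule ℂ (L2pair Ω)) (hA : IsElliptic Ω A lam Lam) (hL : 0 ≤ Lam) :
    Submodule ℂ (L2t (L2 Ω) × L2t (L2 Ω)) where
  carrier := {p | ∃ v : EnergySpace V, toL2H V v = p.1 ∧
    parabolicOp V hA hL v = dualEmb V (embDualT V p.2)}
  add_mem' := by
    rintro p p' ⟨v, h1, h2⟩ ⟨v', h1', h2'⟩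
    exact ⟨v + v', by rw [map_add, h1, h1']; rfl, by
      rw [map_add, h2, h2', Prod.snd_add, map_add, map_add]⟩
  zero_mem' := ⟨0, by rw [map_zero]; rfl, by
    rw [map_zero, Prod.snd_zero, map_zero, map_zero]⟩
  smul_mem' := by
    rintro c p ⟨v, h1, h2⟩
    exact ⟨c • v, by rw [map_smul, h1]; rfl, by
      rw [map_smul, h2, Prod.smul_snd, map_smul, map_smul]⟩

lemma shiftedOp_eq_iff (hA : IsElliptic Ω A lam Lam) (hL : 0 ≤ Lam) (z : ℂ) (u : EnergySpace V)
    (f : L2t (L2 Ω)) : shiftedOp V hA hL z u = dualEmb V (embDualT V f) ↔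
      parabolicOp V hA hL u = dualEmb V (embDualT V (f - z • toL2H V u)) := by
  rw [map_sub, map_sub, map_smul, map_smul, eq_sub_iff_add_eq']
  rfl

variable [CompleteSpace (FormSpace V)]

/-- The function `t ↦ 𝔄(t) v(t)` belongs to `L²(ℝ; V*)`, here stated for its Riesz representative.
The representative comes from the functional `w ↦ ∫ ⟨𝔄(t) v(t), w(t)⟩ dt` on `L²(ℝ; V)`, which
replaces a discussion of the strong measurability of `t ↦ 𝔄(t) v(t)`; the null sets of the
identities for single `w ∈ V` are collected by the separability of `V`. -/
lemma exists_form_repr (hA : IsElliptic Ω A lam Lam) (hL : 0 ≤ Lam) (v : L2t (FormSpace V)) :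
    ∃ a : L2t (FormSpace V), ∀ᵐ t : ℝ, ∀ w : FormSpace V,
      form V (A t) (v t) w = inner ℂ w (a t) := by
  let Φ : AntiDual (L2t (FormSpace V)) := LinearMap.mkContinuous
    { toFun := fun w => ∫ t, form V (A t) (v t) (w t)
      map_add' := by
        intro w w'
        rw [← integral_add (form_time_integrable V hA hL v w).1
          (form_time_integrable V hA hL v w').1]
        refine integral_congr_ae ?_
        filter_upwards [form_time_bounded V hA hL, Lp.coeFn_add w w'] with t ht h1
        obtain ⟨b, hb, -⟩ := ht
        rw [h1, Pi.add_apply]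
        simp only [← hb, map_add]
      map_smul' := by
        intro c w
        rw [smul_eq_mul, ← integral_const_mul]
        refine integral_congr_ae ?_
        filter_upwards [form_time_bounded V hA hL, Lp.coeFn_smul c w] with t ht h1
        obtain ⟨b, hb, -⟩ := ht
        rw [h1, Pi.smul_apply]
        simp only [← hb, map_smulₛₗ, smul_eq_mul] } (Lam * ‖v‖)
    fun w => (form_time_integrable V hA hL v w).2
  have hΦ : ∀ w, inner ℂ w (rieszAnti.symm Φ) = ∫ t, form V (A t) (v t) (w t) :=
    inner_rieszAnti_symm Φ
  set a := rieszAnti.symm Φ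
  refine ⟨a, ?_⟩
  have hc : ∀ c : FormSpace V, ∀ᵐ t : ℝ, form V (A t) (v t) c = inner ℂ c (a t) := by
    intro c
    have ind : ∀ S : Set ℝ, ∀ hS : MeasurableSet S, ∀ hS' : volume S < ⊤,
        (fun t => form V (A t) (v t) (indicatorConstLp 2 hS hS'.ne c t)) =ᵐ[volume]
          S.indicator fun t => form V (A t) (v t) c := by
      intro S hS hS'
      filter_upwards [indicatorConstLp_coeFn (p := 2) (hs := hS) (hμs := hS'.ne) (c := c),
        form_time_bounded V hA hL] with t h1 h2
      obtain ⟨b, hb, -⟩ := h2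
      rw [h1, ← hb]
      by_cases h : t ∈ S
      · simp [h, hb]
      · simp [h]
    refine ae_eq_of_forall_setIntegral_eq_of_sigmaFinite (fun S hS hS' => ?_)
      (fun S hS hS' => ?_) fun S hS hS' => ?_
    · rw [← integrable_indicator_iff hS]
      exact (form_time_integrable V hA hL v (indicatorConstLp 2 hS hS'.ne c)).1.congr
        (ind S hS hS')
    · have : Fact (volume S < ⊤) := ⟨hS'⟩
      have h1 : MemLp a 2 (volume.restrict S) := (Lp.memLp a).restrict S
      exact (h1.integrable one_le_two).const_inner c
    · rw [← integral_indicator hS, ← integral_congr_ae (ind S hS hS'), ← hΦ,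
        L2.inner_indicatorConstLp_eq_setIntegral_inner]
  filter_upwards [ae_all_iff.2 fun k => hc (TopologicalSpace.denseSeq (FormSpace V) k),
    form_time_bounded V hA hL] with t h1 h2
  obtain ⟨b, hb, -⟩ := h2
  have h3 : (fun w => form V (A t) (v t) w) = fun w => inner ℂ w (a t) := by
    refine (TopologicalSpace.denseRange_denseSeq (FormSpace V)).equalizer ?_ (by fun_prop)
      (funext h1)
    simp only [← hb]
    exact (b (v t)).continuous
  exact fun w => congrFun h3 w

lemma dualEmb_apply (f : L2t (AntiDual (FormSpace V))) (w : EnergySpace V) :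
    dualEmb V f w = inner ℂ (toL2V V w)
      ((rieszAnti (X := FormSpace V)).symm.toContinuousLinearEquiv.toContinuousLinearMap.compLpL
        2 volume f) := by
  rw [L2.inner_def]
  refine integral_congr_ae ?_
  filter_upwards [ContinuousLinearMap.coeFn_compLpL (p := 2) (μ := (volume : Measure ℝ))
    (rieszAnti (X := FormSpace V)).symm.toContinuousLinearEquiv.toContinuousLinearMap
    f] with t h1
  rw [h1]
  exact (inner_rieszAnti_symm _ _).symm

/-- The solutions of the pointwise equation in `H¹(ℝ; V*) ∩ L²(ℝ; V)` are the solutions of the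
variational equation in the energy space. -/
lemma isSolution_iff (hA : IsElliptic Ω A lam Lam) (hL : 0 ≤ Lam) (θ : ℂ)
    (f : L2t (AntiDual (FormSpace V))) (v : L2t (FormSpace V)) :
    IsSolution V A θ f v ↔
      ∃ u : EnergySpace V, toL2V V u = v ∧ shiftedOp V hA hL θ u = dualEmb V f := by
  obtain ⟨a, ha⟩ := exists_form_repr hA hL v
  let J : AntiDual (FormSpace V) →L[ℂ] FormSpace V :=
    (rieszAnti (X := FormSpace V)).symm.toContinuousLinearEquiv.toContinuousLinearMap
  let J' : FormSpace V →L[ℂ] AntiDual (FormSpace V) :=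
    (rieszAnti (X := FormSpace V)).toContinuousLinearEquiv.toContinuousLinearMap
  let S : FormSpace V →L[ℂ] FormSpace V := (emb V).adjoint.comp (emb V)
  have hJ : ∀ F w, inner ℂ w (J F) = F w := fun F w => inner_rieszAnti_symm F w
  have hJ' : ∀ x w, J' x w = inner ℂ w x := fun x w => rfl
  have hS : ∀ x w, inner ℂ w (S x) = inner ℂ (emb V w) (emb V x) := fun x w => by
    simp only [S]
    rw [ContinuousLinearMap.comp_apply, ContinuousLinearMap.adjoint_inner_right]
  -- The Riesz representative of the only candidate `f - θ v - 𝔄 v` for the time derivative.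
  let q : L2t (FormSpace V) := J.compLpL 2 volume f - θ • S.compLpL 2 volume v - a
  have hq : ∀ᵐ t : ℝ, ∀ w, inner ℂ w (q t) =
      f t w - θ * inner ℂ (emb V w) (emb V (v t)) - form V (A t) (v t) w := by
    filter_upwards [ha, J.coeFn_compLpL f, S.coeFn_compLpL v,
      Lp.coeFn_smul θ (S.compLpL 2 volume v),
      Lp.coeFn_sub (J.compLpL 2 volume f) (θ • S.compLpL 2 volume v),
      Lp.coeFn_sub (J.compLpL 2 volume f - θ • S.compLpL 2 volume v) a] with t h1 h2 h3 h4 h5 h6 w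
    rw [h6, Pi.sub_apply, h5, Pi.sub_apply, h4, Pi.smul_apply, h3, h2, inner_sub_right,
      inner_sub_right, inner_smul_right, hJ, hS, h1]
  have hSv : J.compLpL 2 volume (embDualT V ((emb V).compLpL 2 volume v)) =
      S.compLpL 2 volume v := by
    refine Lp.ext ?_
    filter_upwards [J.coeFn_compLpL (embDualT V ((emb V).compLpL 2 volume v)),
      (embDual V).coeFn_compLpL ((emb V).compLpL 2 volume v), (emb V).coeFn_compLpL v,
      S.coeFn_compLpL v] with t h1 h2 h3 h4
    rw [h1, h4]
    refine ext_inner_left ℂ fun w => ?_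
    rw [hJ, hS, ← h3]
    exact congrArg (fun F : AntiDual (FormSpace V) => F w) h2
  have hSv' : J'.compLpL 2 volume (S.compLpL 2 volume v) =
      embDualT V ((emb V).compLpL 2 volume v) := by
    rw [← hSv]
    refine Lp.ext ?_
    filter_upwards [J.coeFn_compLpL (embDualT V ((emb V).compLpL 2 volume v)),
      J'.coeFn_compLpL (J.compLpL 2 volume (embDualT V ((emb V).compLpL 2 volume v)))] with t h1 h2
    rw [h2, h1]
    ext w
    rw [hJ', hJ]
  have hweak : IsSolution V A θ f v ↔ HasWeakDeriv (S.compLpL 2 volume v) q := by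
    constructor
    · rintro ⟨u', hu', h⟩
      have h1 := hu'.compLpL J
      rw [hSv] at h1
      have h2 : J.compLpL 2 volume u' = q := by
        refine Lp.ext ?_
        filter_upwards [J.coeFn_compLpL u', h, hq] with t h3 h4 h5
        rw [h3]
        refine ext_inner_left ℂ fun w => ?_
        rw [hJ, h5, ← h4]
        ring
      rwa [h2] at h1
    · intro h
      have h1 := h.compLpL J'
      rw [hSv'] at h1
      refine ⟨_, h1, ?_⟩
      filter_upwards [J'.coeFn_compLpL q, hq] with t h2 h3 w
      rw [h2, hJ', h3]
      ring
  have hint : ∀ w : EnergySpace V, inner ℂ (toL2V V w) q = dualEmb V f w -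
      θ * inner ℂ (toL2H V w) ((emb V).compLpL 2 volume v) -
      ∫ t, form V (A t) (v t) (toL2V V w t) := by
    intro w
    have e1 : inner ℂ (toL2V V w) (S.compLpL 2 volume v) =
        inner ℂ (toL2H V w) ((emb V).compLpL 2 volume v) := by
      rw [L2.inner_def, L2.inner_def, toL2H_apply]
      refine integral_congr_ae ?_
      filter_upwards [S.coeFn_compLpL v, (emb V).coeFn_compLpL v,
        (emb V).coeFn_compLpL (toL2V V w)] with t h1 h2 h3
      rw [h1, h2, h3, hS]
    have e2 : inner ℂ (toL2V V w) a = ∫ t, form V (A t) (v t) (toL2V V w t) := by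
      rw [L2.inner_def]
      refine integral_congr_ae ?_
      filter_upwards [ha] with t h1
      rw [h1]
    rw [inner_sub_right, inner_sub_right, inner_smul_right, e1, e2, dualEmb_apply]
  rw [hweak, hasWeakDeriv_iff_fourier]
  have hsymbol : (∀ᵐ ξ : ℝ, 𝓕 q ξ = (2 * Real.pi * Complex.I * ξ : ℂ) •
      𝓕 (S.compLpL 2 volume v) ξ) ↔
      ∀ᵐ ξ : ℝ, 𝓕 q ξ = (2 * Real.pi * Complex.I * ξ : ℂ) • S (𝓕 v ξ) := by
    rw [fourier_compLpL]
    refine Filter.eventually_congr ?_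
    filter_upwards [S.coeFn_compLpL (𝓕 v)] with ξ h1
    rw [h1]
  rw [hsymbol, fourier_eq_iff_exists_halfDeriv]
  constructor
  · rintro ⟨h, hh, hw⟩
    refine ⟨.mk v h hh, rfl, ?_⟩
    ext w
    have h1 := hw (toL2V V w) (halfDeriv V w) (isHalfDeriv_halfDeriv w)
    rw [hint] at h1
    rw [shiftedOp_apply, halfDeriv_mk, h1, toL2H_apply (.mk v h hh), toL2V_mk]
    ring
  · rintro ⟨u, rfl, hu⟩
    refine ⟨halfDeriv V u, isHalfDeriv_halfDeriv u, fun w k hk => ?_⟩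
    have h1 := congrArg (fun F : AntiDual (EnergySpace V) => F (.mk w k hk)) hu
    have h2 := hint (.mk w k hk)
    rw [shiftedOp_apply] at h1
    rw [← h1] at h2
    change _ = inner ℂ (toL2V V (.mk w k hk)) q
    rw [h2, toL2H_apply u, halfDeriv_mk]
    ring

/-- The embedding of `L²(ℝ; H)` into the anti-dual of the energy space is injective, since the
energy space is dense in `L²(ℝ; H)`. -/
lemma dualEmb_embDualT_injective (hΩ : IsOpen Ω) (hV : IsFormDomain Ω V) :
    Function.Injective fun f : L2t (L2 Ω) => dualEmb V (embDualT V f) := by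
  intro f g h
  rw [← sub_eq_zero]
  refine eq_zero_of_forall_inner_halfDeriv (emb V) (denseRange_emb hΩ hV) _ fun w k hk => ?_
  have h1 := congrArg (fun F : AntiDual (EnergySpace V) => F (.mk w k hk)) h
  simp only at h1
  rw [dualEmb_embDualT_apply, dualEmb_embDualT_apply] at h1
  rw [inner_sub_right, sub_eq_zero]
  exact h1

/-- The part of `𝔏` in `L²(ℝ; H)` is well defined and maximal accretive. -/
lemma exists_maximalAccretive_part (hΩ : IsOpen Ω) (hV : IsFormDomain Ω V)
    (hA : IsElliptic Ω A lam Lam) (hlam : 0 < lam) (hL : 0 ≤ Lam) (hle : lam ≤ Lam) :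
    ∃ T : L2t (L2 Ω) →ₗ.[ℂ] L2t (L2 Ω),
      (∀ u f : L2t (L2 Ω), (u, f) ∈ T.graph ↔
        ∃ v : EnergySpace V, toL2H V v = u ∧
          parabolicOp V hA hL v = dualEmb V (embDualT V f)) ∧
      IsMaximalAccretive T := by
  have hg : (partGraph V hA hL).toLinearPMap.graph = partGraph V hA hL := by
    refine Submodule.toLinearPMap_graph_eq _ ?_
    rintro ⟨u, f⟩ ⟨v, h1, h2⟩ (hu : u = 0)
    refine dualEmb_embDualT_injective hΩ hV ?_
    change dualEmb V (embDualT V f) = dualEmb V (embDualT V 0)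
    have hv : v = 0 := toL2H_injective hΩ hV (by rw [h1, map_zero]; exact hu)
    change parabolicOp V hA hL v = dualEmb V (embDualT V f) at h2
    rw [← h2, hv, map_zero, map_zero, map_zero]
  set T := (partGraph V hA hL).toLinearPMap with hTdef
  have hmem : ∀ u f : L2t (L2 Ω), (u, f) ∈ T.graph ↔ ∃ v : EnergySpace V, toL2H V v = u ∧
      parabolicOp V hA hL v = dualEmb V (embDualT V f) := by
    intro u f
    rw [hg]
    rfl
  refine ⟨T, hmem, isMaximalAccretive_of_resolvent T ?_ ?_⟩
  · intro u
    obtain ⟨v, h1, h2⟩ := (hmem _ _).1 (T.mem_graph u)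
    rw [← h1, ← dualEmb_embDualT_apply, ← h2, parabolicOp_apply, Complex.add_re, Complex.neg_re,
      re_inner_hilbertT_self, neg_zero, zero_add]
    exact (by positivity : 0 ≤ lam * ‖gradT V (toL2V V v)‖ ^ 2).trans
      (hA.integral_form_coercive hL _)
  · intro z hz f
    obtain ⟨v, hv, -⟩ := (shiftedOp_bijective_and_norm_le hA hlam hL hle z hz).1
      (dualEmb V (embDualT V f))
    have h1 := (hmem (toL2H V v) (f - z • toL2H V v)).2
      ⟨v, rfl, (shiftedOp_eq_iff hA hL z v f).1 hv⟩
    obtain ⟨u, hu1, hu2⟩ := (LinearPMap.mem_graph_iff T).1 h1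
    exact ⟨u, by rw [hu1, hu2, add_sub_cancel]⟩

end Equation

end

end NonAuto

theorem lemma2p1 {n : ℕ} (hn : 0 < n)
    (Ω : Set (EuclideanSpace ℝ (Fin n))) (hΩ : IsOpen Ω) (hΩ' : Ω.Nonempty)
    (V : Submodule ℂ (NonAuto.L2pair Ω)) (hV : NonAuto.IsFormDomain Ω V)
    (A : ℝ → EuclideanSpace ℝ (Fin n) → Matrix (Fin n) (Fin n) ℂ)
    (lam Lam : ℝ) (hlam : 0 < lam) (hLam : 0 < Lam) (hA : NonAuto.IsElliptic Ω A lam Lam)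
    (θ : ℂ) (hθ : 0 < θ.re) :
    -- unique solvability in the energy space, with the norm bound
    (∀ f : NonAuto.AntiDual (NonAuto.EnergySpace V),
      ∃! u : NonAuto.EnergySpace V, NonAuto.shiftedOp V hA hLam.le θ u = f) ∧
    (∀ (f : NonAuto.AntiDual (NonAuto.EnergySpace V)) (u : NonAuto.EnergySpace V),
      NonAuto.shiftedOp V hA hLam.le θ u = f →
        ‖u‖ ≤ √2 * max ((Lam + 1) / lam) ((|θ.im| + 1) / θ.re) * ‖f‖) ∧
    -- data in `L²(ℝ; V*)`
    (∀ (f : NonAuto.L2t (NonAuto.AntiDual (NonAuto.FormSpace V))) (u : NonAuto.EnergySpace V),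
      NonAuto.shiftedOp V hA hLam.le θ u = NonAuto.dualEmb V f →
        NonAuto.IsSolution V A θ f (NonAuto.toL2V V u) ∧
        ∀ v : NonAuto.L2t (NonAuto.FormSpace V),
          NonAuto.IsSolution V A θ f v → v = NonAuto.toL2V V u) ∧
    -- data in `L²(ℝ; H)`
    (∀ (f : NonAuto.L2t (NonAuto.L2 Ω)) (u : NonAuto.EnergySpace V),
      NonAuto.shiftedOp V hA hLam.le θ u = NonAuto.dualEmb V (NonAuto.embDualT V f) →
        ‖NonAuto.toL2H V u‖ ≤ 1 / θ.re * ‖f‖) ∧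
    -- the part `T` of `𝔏` in `L²(ℝ; H)`
    ∃ T : NonAuto.L2t (NonAuto.L2 Ω) →ₗ.[ℂ] NonAuto.L2t (NonAuto.L2 Ω),
      (∀ u f : NonAuto.L2t (NonAuto.L2 Ω), (u, f) ∈ T.graph ↔
        ∃ v : NonAuto.EnergySpace V, NonAuto.toL2H V v = u ∧
          NonAuto.parabolicOp V hA hLam.le v = NonAuto.dualEmb V (NonAuto.embDualT V f)) ∧
      NonAuto.IsMaximalAccretive T ∧
      ∀ u : NonAuto.L2t (NonAuto.L2 Ω), u ∈ T.domain ↔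
        ∃ v : NonAuto.L2t (NonAuto.FormSpace V),
          (NonAuto.emb V).compLpL 2 MeasureTheory.volume v = u ∧
          ∃ f : NonAuto.L2t (NonAuto.L2 Ω),
            NonAuto.IsSolution V A 0 (NonAuto.embDualT V f) v := by
  have : CompleteSpace (NonAuto.FormSpace V) := hV.completeSpace
  have hle : lam ≤ Lam := hA.le hn hΩ hΩ'
  have hsolve := NonAuto.shiftedOp_bijective_and_norm_le (V := V) hA hlam hLam.le hle θ hθ
  refine ⟨hsolve.1, ?_, ?_, ?_, ?_⟩
  · rintro f u rfl
    exact hsolve.2 u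
  · intro f u hu
    refine ⟨(NonAuto.isSolution_iff hA hLam.le θ f _).2 ⟨u, rfl, hu⟩, fun v hv => ?_⟩
    obtain ⟨w, rfl, hw⟩ := (NonAuto.isSolution_iff hA hLam.le θ f v).1 hv
    rw [(hsolve.1 _).unique hw hu]
  · intro f u hu
    have h1 := NonAuto.re_shiftedOp_self hA hLam.le θ u
    rw [hu, NonAuto.dualEmb_embDualT_apply] at h1
    have h2 := (Complex.re_le_norm _).trans (norm_inner_le_norm (𝕜 := ℂ) (NonAuto.toL2H V u) f)
    have h3 : 0 ≤ lam * ‖NonAuto.gradT V (NonAuto.toL2V V u)‖ ^ 2 := by positivity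
    rw [one_div, ← div_eq_inv_mul, le_div_iff₀ hθ]
    rcases eq_or_lt_of_le (norm_nonneg (NonAuto.toL2H V u)) with h | h
    · rw [← h, zero_mul]
      exact norm_nonneg f
    · refine le_of_mul_le_mul_left (a := ‖NonAuto.toL2H V u‖) ?_ h
      linarith
  · obtain ⟨T, hT, hmax⟩ :=
      NonAuto.exists_maximalAccretive_part hΩ hV hA hlam hLam.le hle
    refine ⟨T, hT, hmax, fun u => ?_⟩
    have h0 : ∀ (v : NonAuto.EnergySpace V) (f : NonAuto.L2t (NonAuto.L2 Ω)),
        NonAuto.shiftedOp V hA hLam.le 0 v = NonAuto.dualEmb V (NonAuto.embDualT V f) ↔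
        NonAuto.parabolicOp V hA hLam.le v = NonAuto.dualEmb V (NonAuto.embDualT V f) := by
      intro v f
      rw [NonAuto.shiftedOp_eq_iff, zero_smul, sub_zero]
    rw [LinearPMap.mem_domain_iff]
    constructor
    · rintro ⟨f, hf⟩
      obtain ⟨v, hv, hvf⟩ := (hT u f).1 hf
      exact ⟨NonAuto.toL2V V v, hv, f,
        (NonAuto.isSolution_iff hA hLam.le 0 _ _).2 ⟨v, rfl, (h0 v f).2 hvf⟩⟩
    · rintro ⟨v, rfl, f, hf⟩
      obtain ⟨w, rfl, hw⟩ := (NonAuto.isSolution_iff hA hLam.le 0 _ _).1 hf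
      exact ⟨f, (hT _ f).2 ⟨w, rfl, (h0 w f).1 hw⟩⟩
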